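/- **Language and algebras.** Let $\mathcal F,\mathcal G$ be disjoint sets of connectives; each connective $h$ has an arity $n_h\ge 0$ and an order type $\varepsilon_h\in\{1,\partial\}^{n_h}$. The $\mathcal L_{\mathrm{LE}}$-terms are built from countably many proposition letters, $\bot,\top,\wedge,\vee$ and the connectives in $\mathcal F\cup\mathcal G$. An $\mathcal L_{\mathrm{LE}}$-algebra (LE) $\mathbb A$ is a bounded lattice with an $n_h$-ary operation for each connective $h$, such that each $f\in\mathcal F$ preserves finite (also empty) joins in each coordinate $i$ with $\varepsilon_f(i)=1$ and turns finite meets into joins in each coordinate with $\varepsilon_f(i)=\partial$, and each $g\in\mathcal G$ preserves finite meets in each coordinate with $\varepsilon_g(i)=1$ and turns finite joins into meets in each coordinate with $\varepsilon_g(i)=\partial$. An inequality $\phi\le\psi$ is valid in $\mathbb A$ if $v(\phi)\le v(\psi)$ for all assignments $v$ of elements of $\mathbb A$ to the proposition letters. **Canonical extensions.** A canonical extension of a bounded lattice $A$ is a complete lattice $C$ containing $A$ as a bounded sublattice such that every element of $C$ is both a join of meets and a meet of joins of subsets of $A$ (denseness), and whenever $S,T\subseteq A$ satisfy $\bigwedge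 S\le\bigvee T$ in $C$ there are finite $S'\subseteq S$, $T'\subseteq T$ with $\bigwedge S'\le\bigvee T'$ (compactness). Let $K$ (closed elements) and $O$ (open elements) be the sets of meets, resp. joins, in $C$ of subsets of $A$; for an order type $\varepsilon$, $\le^\varepsilon$ is the coordinatewise order reversed where $\varepsilon_i=\partial$, $K^\varepsilon$ is the set of tuples with coordinates in $K$ where $\varepsilon_i=1$ and in $O$ where $\varepsilon_i=\partial$, and $O^\varepsilon$ is defined with $K$ and $O$ interchanged. The canonical extension $\mathbb A^\delta$ of an LE $\mathbb A$ with lattice $A$ is $C$ with the operations, for $f\in\mathcal F$ and $g\in\mathcal G$, $$f^\sigma(\bar u)=\bigvee\Big\{\bigwedge\{f(\bar a):\bar a\in A^{n_f},\ \bar k\le^{\varepsilon_f}\bar a\}: \bar k\in K^{\varepsilon_f},\ \bar k\le^{\varepsilon_f}\bar u\Big\},$$ $$g^\pi(\bar u)=\bigwedge\Big\{\bigvee\{g(\bar a):\bar a\in A^{n_g},\ \bar a\le^{\varepsilon_g}\bar o\}: \bar o\in O^{\varepsilon_g},\ \bar u\le^{\varepsilon_g}\bar o\Big\}.$$ **Signs.**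 The signed generation tree $+s$ (resp. $-s$) of a term gives the root the sign $+$ (resp. $-$); a child has the sign of its parent, except that it has the opposite sign if it is in a coordinate of order type $\partial$ of a connective. A term is positive (negative) in an atom $p$ if all occurrences of $p$ in $+s$ have the sign $+$ ($-$). A node is *SLR* if it is $+f$ or $-g$ with $f\in\mathcal F$, $g\in\mathcal G$ of arity at least $1$. In an inequality $s\le t$ the trees $+s$ and $-t$ are considered. **Expanded language.** $\mathcal L^+_{\mathrm{LE}}$ has as further atoms nominals $\mathbf j_0,\mathbf j_1,\dots$ and co-nominals $\mathbf m_0,\mathbf m_1,\dots$, and as further connectives $f^\sharp_i$ ($f\in\mathcal F$, $1\le i\le n_f$; in $\mathcal G^*$ if $\varepsilon_f(i)=1$, in $\mathcal F^*$ if $\varepsilon_f(i)=\partial$) and $g^\flat_i$ ($g\in\mathcal G$, $1\le i\le n_g$; in $\mathcal F^*$ if $\varepsilon_g(i)=1$, in $\mathcal G^*$ if $\varepsilon_g(i)=\partial$). For $h^\star_i\in\{f^\sharp_i,g^\flat_i\}$ the arity is $n_h$ and the order type is: $1$ at $i$ and opposite to $\varepsilon_h$ elsewhere if $\varepsilon_h(i)=1$;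 equal to $\varepsilon_h$ if $\varepsilon_h(i)=\partial$. Signs are defined in the same way. An expression is pure if no proposition letter occurs in it. **ALBA.** *Stage 1* transforms $\phi\le\psi$, in this order, by exhaustive application of: (1) elimination of a letter $p$ occurring in $\alpha\le\beta$: $p$ is replaced by $\bot$ if $\alpha$ is negative and $\beta$ positive in $p$, and by $\top$ if $\alpha$ is positive and $\beta$ negative in $p$; (2) distribution, at any node, of $+f$ over a child $+\vee$ or $-\wedge$ (giving a join of two $f$-terms) and of $-g$ over a child $-\wedge$ or $+\vee$ (giving a meet of two $g$-terms); (3) splitting: $\alpha\le\beta\wedge\gamma$ is replaced by $\alpha\le\beta$ and $\alpha\le\gamma$, and $\alpha\vee\beta\le\gamma$ by $\alpha\le\gamma$ and $\beta\le\gamma$. Each resulting inequality $\phi'\le\psi'$ gives an initial system $(\varnothing,\phi'\le\psi')$. *Stage 2* transforms systems $(S,\mathsf{Ineq})$, with $S$ a finite set of $\mathcal L^+_{\mathrm{LE}}$-inequalities and $\mathsf{Ineq}$ an $\mathcal L^+_{\mathrm{LE}}$-inequality, by the following rules. - *Approximation.* If $\mathsf{Ineq}$ is $\phi'(\gamma/!x)\le\psi$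 or $\phi\le\psi'(\gamma/!x)$, where $x$ occurs exactly once in $\phi'$ resp. $\psi'$, all nodes above $x$ in $+\phi'$ resp. $-\psi'$ are SLR nodes, and $\gamma$ is an $\mathcal L_{\mathrm{LE}}$-term: if $x$ has the sign $+$ in that tree, replace this occurrence of $\gamma$ in $\mathsf{Ineq}$ by the first nominal $\mathbf j$ not occurring in the system and add $\mathbf j\le\gamma$ to $S$; if $x$ has the sign $-$, replace it by the first co-nominal $\mathbf m$ not occurring in the system and add $\gamma\le\mathbf m$ to $S$. The application is *pivotal* if the SLR branch is maximal, i.e. the root of $\gamma$, with the sign of $x$, is not an SLR node. - *Residuation*, rewriting a member of $S$: $f(\bar\phi)\le\psi$ becomes $\phi_i\le f^\sharp_i(\bar\phi[\psi/\phi_i])$ if $\varepsilon_f(i)=1$, and $f^\sharp_i(\bar\phi[\psi/\phi_i])\le\phi_i$ if $\varepsilon_f(i)=\partial$; $\psi\le g(\bar\phi)$ becomes $g^\flat_i(\bar\phi[\psi/\phi_i])\le\phi_i$ if $\varepsilon_g(i)=1$, and $\phi_i\le g^\flat_i(\bar\phi[\psi/\phi_i])$ if $\varepsilon_g(i)=\partial$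 (here $\bar\phi[\psi/\phi_i]$ is $\bar\phi$ with $\psi$ in the $i$th place). - *Splitting* of a member of $S$. - *Ackermann.* If $S=\{\alpha_i\le p\mid 1\le i\le n\}\cup\{\beta_j\le\gamma_j\mid 1\le j\le m\}$ with $n,m\ge0$, $p$ does not occur in $\alpha_1,\dots,\alpha_n,\mathsf{Ineq}$, all $\beta_j$ are positive and all $\gamma_j$ negative in $p$, then replace $S$ by $\{\beta_j(\alpha/p)\le\gamma_j(\alpha/p)\mid 1\le j\le m\}$ with $\alpha=\bigvee_{i=1}^n\alpha_i$. Dually, if $S=\{p\le\alpha_i\mid 1\le i\le n\}\cup\{\beta_j\le\gamma_j\mid 1\le j\le m\}$, $p$ does not occur in $\alpha_1,\dots,\alpha_n,\mathsf{Ineq}$, all $\beta_j$ are negative and all $\gamma_j$ positive in $p$, do the same with $\alpha=\bigwedge_{i=1}^n\alpha_i$. ALBA *succeeds pivotally* on $\phi\le\psi$ if some execution, in which all applications of approximation rules are pivotal, transforms every initial system into a pure system. **Theorem.** Every $\mathcal L_{\mathrm{LE}}$-inequality $\phi\le\psi$ on which ALBA succeeds pivotally is canonical: for every $\mathcal L_{\mathrm{LE}}$-algebra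 $\mathbb A$, if $\phi\le\psi$ is valid in $\mathbb A$, then it is valid in the canonical extension $\mathbb A^\delta$. -/

import Mathlib

universe u v w

namespace LatExp

/-! ### Languages and terms -/

/-- The two values `1`, `∂` of an order type, and also the two signs `+`, `-` of the nodes of a
signed generation tree: `pos` is `1` or `+`, and `neg` is `∂` or `-`. -/
inductive Pol : Type
  | pos
  | neg

/-- The opposite value. -/
def Pol.op : Pol → Pol
  | .pos => .neg
  | .neg => .pos

/-- `s.through ε` is the sign of a child node sitting in a coordinate of order type `ε` of a node
with sign `s`: the same sign if `ε = 1`, the opposite sign if `ε = ∂`. -/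
def Pol.through (s : Pol) : Pol → Pol
  | .pos => s
  | .neg => s.op

/-- The parameters `(F, G)` of a language of lattice expansions: two (disjoint) families of
connectives, each connective having an arity and an order type over its arity. -/
structure Signature : Type (u + 1) where
  F : Type u
  G : Type u
  arF : F → ℕ
  arG : G → ℕ
  epsF : (f : F) → Fin (arF f) → Pol
  epsG : (g : G) → Fin (arG g) → Pol

/-- Terms over the signature `L` with atoms from `V`. -/
inductive Term (L : Signature.{u}) (V : Type) : Type u
  | atom (x : V) : Term L V
  | bot : Term L V
  | top : Term L V
  | meet (s t : Term L V) : Term L V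
  | join (s t : Term L V) : Term L V
  | opF (f : L.F) (args : Fin (L.arF f) → Term L V) : Term L V
  | opG (g : L.G) (args : Fin (L.arG g) → Term L V) : Term L V

/-- Inequalities `lhs ≤ rhs` between terms. -/
@[ext]
structure Ineq (L : Signature.{u}) (V : Type) : Type u where
  lhs : Term L V
  rhs : Term L V

noncomputable instance (L : Signature.{u}) (V : Type) : DecidableEq (Ineq L V) :=
  Classical.decEq _

namespace Term

variable {L : Signature.{u}} {V : Type}

/-- The atom `x` occurs in the term. -/
def Occurs (x : V) : Term L V → Prop
  | atom y => y = x
  | bot => False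
  | top => False
  | meet s t => s.Occurs x ∨ t.Occurs x
  | join s t => s.Occurs x ∨ t.Occurs x
  | opF _ a => ∃ i, (a i).Occurs x
  | opG _ a => ∃ i, (a i).Occurs x

/-- `OccursWith x σ s t`: some leaf labelled `x` has the sign `σ` in the generation tree of `t`
whose root has the sign `s`. -/
def OccursWith (x : V) (σ : Pol) : Pol → Term L V → Prop
  | s, atom y => y = x ∧ s = σ
  | _, bot => False
  | _, top => False
  | s, meet t t' => t.OccursWith x σ s ∨ t'.OccursWith x σ s
  | s, join t t' => t.OccursWith x σ s ∨ t'.OccursWith x σ s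
  | s, opF f a => ∃ i, (a i).OccursWith x σ (s.through (L.epsF f i))
  | s, opG g a => ∃ i, (a i).OccursWith x σ (s.through (L.epsG g i))

/-- The term is positive in `x`: every occurrence of `x` in its positive generation tree is
positive. -/
def PositiveIn (x : V) (t : Term L V) : Prop := ¬ t.OccursWith x .neg .pos

/-- The term is negative in `x`: every occurrence of `x` in its positive generation tree is
negative. -/
def NegativeIn (x : V) (t : Term L V) : Prop := ¬ t.OccursWith x .pos .pos

/-- `Term.subst x r t` is `t(r/x)`. -/
def subst [DecidableEq V] (x : V) (r : Term L V) : Term L V → Term L V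
  | atom y => if y = x then r else atom y
  | bot => bot
  | top => top
  | meet s t => meet (subst x r s) (subst x r t)
  | join s t => join (subst x r s) (subst x r t)
  | opF f a => opF f fun i => subst x r (a i)
  | opG g a => opG g fun i => subst x r (a i)

/-- The finite join of a list of terms; it is `⊥` for the empty list. -/
def bigJoin : List (Term L V) → Term L V
  | [] => bot
  | [a] => a
  | a :: b :: l => join a (bigJoin (b :: l))

/-- The finite meet of a list of terms; it is `⊤` for the empty list. -/
def bigMeet : List (Term L V) → Term L V
  | [] => top
  | [a] => a
  | a :: b :: l => meet a (bigMeet (b :: l))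

/-- With the sign `s` at the root of the term, this root is a syntactically left residual (SLR)
node: it is `+f` or `-g` for a connective `f ∈ F` or `g ∈ G` of arity at least `1`. -/
def RootSLR : Pol → Term L V → Prop
  | .pos, opF f _ => 1 ≤ L.arF f
  | .neg, opG g _ => 1 ≤ L.arG g
  | _, _ => False

end Term

/-- `i.subst x r` is the result of the substitution of `r` for `x` in both sides. -/
def Ineq.subst {L : Signature.{u}} {V : Type} [DecidableEq V] (x : V) (r : Term L V)
    (i : Ineq L V) : Ineq L V :=
  ⟨Term.subst x r i.lhs, Term.subst x r i.rhs⟩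

/-- The atom `x` occurs in the inequality. -/
def Ineq.Occurs {L : Signature.{u}} {V : Type} (x : V) (i : Ineq L V) : Prop :=
  i.lhs.Occurs x ∨ i.rhs.Occurs x

/-- Terms `φ(!x)` with exactly one occurrence of a placeholder `x`. In `opF f i args C` and
`opG g i args C` the placeholder is in the `i`-th argument, which is `C`, and the entry `args i` is
not used. -/
inductive Ctx (L : Signature.{u}) (V : Type) : Type u
  | hole : Ctx L V
  | meetL (C : Ctx L V) (t : Term L V) : Ctx L V
  | meetR (t : Term L V) (C : Ctx L V) : Ctx L V
  | joinL (C : Ctx L V) (t : Term L V) : Ctx L V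
  | joinR (t : Term L V) (C : Ctx L V) : Ctx L V
  | opF (f : L.F) (i : Fin (L.arF f)) (args : Fin (L.arF f) → Term L V) (C : Ctx L V) : Ctx L V
  | opG (g : L.G) (i : Fin (L.arG g)) (args : Fin (L.arG g) → Term L V) (C : Ctx L V) : Ctx L V

namespace Ctx

variable {L : Signature.{u}} {V : Type}

/-- `C.plug γ` is `φ(γ/!x)`. -/
def plug : Ctx L V → Term L V → Term L V
  | hole, γ => γ
  | meetL C t, γ => .meet (C.plug γ) t
  | meetR t C, γ => .meet t (C.plug γ)
  | joinL C t, γ => .join (C.plug γ) t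
  | joinR t C, γ => .join t (C.plug γ)
  | opF f i a C, γ => .opF f (Function.update a i (C.plug γ))
  | opG g i a C, γ => .opG g (Function.update a i (C.plug γ))

/-- The sign of the placeholder in the generation tree whose root has the sign `s`. -/
def sign : Pol → Ctx L V → Pol
  | s, hole => s
  | s, meetL C _ => C.sign s
  | s, meetR _ C => C.sign s
  | s, joinL C _ => C.sign s
  | s, joinR _ C => C.sign s
  | s, opF f i _ C => C.sign (s.through (L.epsF f i))
  | s, opG g i _ C => C.sign (s.through (L.epsG g i))

/-- In the generation tree whose root has the sign `s`, the branch from the placeholder to the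
root is SLR: all its nodes above the placeholder are SLR nodes, that is, they are labelled `+f`
or `-g`. -/
def SLR : Pol → Ctx L V → Prop
  | _, hole => True
  | _, meetL _ _ => False
  | _, meetR _ _ => False
  | _, joinL _ _ => False
  | _, joinR _ _ => False
  | s, opF f i _ C => s = .pos ∧ C.SLR (s.through (L.epsF f i))
  | s, opG g i _ C => s = .neg ∧ C.SLR (s.through (L.epsG g i))

end Ctx

/-! ### The expanded language -/

/-- The family `F*`: the connectives of `F`, the `f♯ᵢ` with `ε_f(i) = ∂`, and the `g♭ᵢ` with
`ε_g(i) = 1`. -/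
inductive TenseF (L : Signature.{u}) : Type u
  | base (f : L.F) : TenseF L
  | sharp (f : L.F) (i : Fin (L.arF f)) (h : L.epsF f i = .neg) : TenseF L
  | flat (g : L.G) (i : Fin (L.arG g)) (h : L.epsG g i = .pos) : TenseF L

/-- The family `G*`: the connectives of `G`, the `f♯ᵢ` with `ε_f(i) = 1`, and the `g♭ᵢ` with
`ε_g(i) = ∂`. -/
inductive TenseG (L : Signature.{u}) : Type u
  | base (g : L.G) : TenseG L
  | sharp (f : L.F) (i : Fin (L.arF f)) (h : L.epsF f i = .pos) : TenseG L
  | flat (g : L.G) (i : Fin (L.arG g)) (h : L.epsG g i = .neg) : TenseG L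

/-- The order type of the residual in the `i`-th coordinate of an operation of order type `ε`:
if `ε i = 1`, it is `1` at `i` and opposite to `ε` elsewhere; if `ε i = ∂`, it is `∂` at `i` and
agrees with `ε` elsewhere. -/
def residualType {n : ℕ} (ε : Fin n → Pol) (i : Fin n) : Fin n → Pol := fun j =>
  match ε i with
  | .pos => if j = i then .pos else (ε j).op
  | .neg => ε j

/-- The signature of the tense language `L*`. -/
abbrev Signature.tense (L : Signature.{u}) : Signature.{u} where
  F := TenseF L
  G := TenseG L
  arF
    | .base f => L.arF f
    | .sharp f _ _ => L.arF f
    | .flat g _ _ => L.arG g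
  arG
    | .base g => L.arG g
    | .sharp f _ _ => L.arF f
    | .flat g _ _ => L.arG g
  epsF
    | .base f => L.epsF f
    | .sharp f i _ => residualType (L.epsF f) i
    | .flat g i _ => residualType (L.epsG g) i
  epsG
    | .base g => L.epsG g
    | .sharp f i _ => residualType (L.epsF f) i
    | .flat g i _ => residualType (L.epsG g) i

/-- The atoms of the expanded language: proposition letters, nominals and co-nominals. -/
inductive Atom : Type
  | prop (k : ℕ)
  | nom (k : ℕ)
  | conom (k : ℕ)
  deriving DecidableEq

/-- Terms of the base language; the proposition letters are indexed by `ℕ`. -/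
abbrev BTerm (L : Signature.{u}) : Type u := Term L ℕ

/-- Terms of the expanded language `L⁺`. -/
abbrev ETerm (L : Signature.{u}) : Type u := Term L.tense Atom

/-- Inequalities of the base language. -/
abbrev BIneq (L : Signature.{u}) : Type u := Ineq L ℕ

/-- Inequalities of the expanded language. -/
abbrev EIneq (L : Signature.{u}) : Type u := Ineq L.tense Atom

/-- The inclusion of the base language in the expanded language. -/
def Term.embed {L : Signature.{u}} : BTerm L → ETerm L
  | .atom p => .atom (.prop p)
  | .bot => .bot
  | .top => .top
  | .meet s t => .meet s.embed t.embed
  | .join s t => .join s.embed t.embed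
  | .opF f a => .opF (L := L.tense) (TenseF.base f) fun i => (a i).embed
  | .opG g a => .opG (L := L.tense) (TenseG.base g) fun i => (a i).embed

/-- The inclusion of inequalities of the base language in those of the expanded language. -/
def Ineq.embed {L : Signature.{u}} (i : BIneq L) : EIneq L := ⟨i.lhs.embed, i.rhs.embed⟩

/-! ### Stage 1 of ALBA: preprocessing -/

section Preprocessing

variable {L : Signature.{u}}

/-- `b` is obtained from `a` by exhaustive application of the rules `R`. -/
def Exhaustively {α : Type*} (R : α → α → Prop) (a b : α) : Prop :=
  Relation.ReflTransGen R a b ∧ ∀ c, ¬ R b c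

/-- Elimination of one proposition letter that occurs in the inequality and is uniform in it. -/
inductive ElimStep : BIneq L → BIneq L → Prop
  | toBot (α β : BTerm L) (p : ℕ) (hp : α.Occurs p ∨ β.Occurs p)
      (hα : α.NegativeIn p) (hβ : β.PositiveIn p) :
      ElimStep ⟨α, β⟩ ⟨Term.subst p .bot α, Term.subst p .bot β⟩
  | toTop (γ δ : BTerm L) (p : ℕ) (hp : γ.Occurs p ∨ δ.Occurs p)
      (hγ : γ.PositiveIn p) (hδ : δ.NegativeIn p) :
      ElimStep ⟨γ, δ⟩ ⟨Term.subst p .top γ, Term.subst p .top δ⟩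

/-- `DistRedex s t t'`: at a node of sign `s`, the term `t` is rewritten to `t'` by distributing
`+f` over a child `+∨` or `-∧`, or `-g` over a child `-∧` or `+∨`. -/
inductive DistRedex : Pol → BTerm L → BTerm L → Prop
  | fJoin (f : L.F) (i : Fin (L.arF f)) (h : L.epsF f i = .pos) (a : Fin (L.arF f) → BTerm L)
      (x y : BTerm L) :
      DistRedex .pos (.opF f (Function.update a i (.join x y)))
        (.join (.opF f (Function.update a i x)) (.opF f (Function.update a i y)))
  | fMeet (f : L.F) (i : Fin (L.arF f)) (h : L.epsF f i = .neg) (a : Fin (L.arF f) → BTerm L)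
      (x y : BTerm L) :
      DistRedex .pos (.opF f (Function.update a i (.meet x y)))
        (.join (.opF f (Function.update a i x)) (.opF f (Function.update a i y)))
  | gMeet (g : L.G) (i : Fin (L.arG g)) (h : L.epsG g i = .pos) (a : Fin (L.arG g) → BTerm L)
      (x y : BTerm L) :
      DistRedex .neg (.opG g (Function.update a i (.meet x y)))
        (.meet (.opG g (Function.update a i x)) (.opG g (Function.update a i y)))
  | gJoin (g : L.G) (i : Fin (L.arG g)) (h : L.epsG g i = .neg) (a : Fin (L.arG g) → BTerm L)
      (x y : BTerm L) :
      DistRedex .neg (.opG g (Function.update a i (.join x y)))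
        (.meet (.opG g (Function.update a i x)) (.opG g (Function.update a i y)))

/-- One distribution step at some node of the positive generation tree of the left-hand side or of
the negative generation tree of the right-hand side. -/
inductive DistStep : BIneq L → BIneq L → Prop
  | left (C : Ctx L ℕ) (s s' t : BTerm L) (h : DistRedex (C.sign .pos) s s') :
      DistStep ⟨C.plug s, t⟩ ⟨C.plug s', t⟩
  | right (C : Ctx L ℕ) (s t t' : BTerm L) (h : DistRedex (C.sign .neg) t t') :
      DistStep ⟨s, C.plug t⟩ ⟨s, C.plug t'⟩

/-- The splitting rules: the first inequality is replaced by the two others. -/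
inductive Splits {L : Signature.{u}} {V : Type} : Ineq L V → Ineq L V → Ineq L V → Prop
  | meet (α β γ : Term L V) : Splits ⟨α, .meet β γ⟩ ⟨α, β⟩ ⟨α, γ⟩
  | join (α β γ : Term L V) : Splits ⟨.join α β, γ⟩ ⟨α, γ⟩ ⟨β, γ⟩

/-- One application of a splitting rule to a member of a finite set of inequalities. -/
inductive SplitStep {L : Signature.{u}} {V : Type} :
    Finset (Ineq L V) → Finset (Ineq L V) → Prop
  | mk (S : Finset (Ineq L V)) (i j k : Ineq L V) (hi : i ∈ S) (h : Splits i j k) :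
      SplitStep S (insert j (insert k (S.erase i)))

/-- `I` is a set of inequalities that the preprocessing produces from the inequality `i`. -/
def Preprocess (i : BIneq L) (I : Finset (BIneq L)) : Prop :=
  ∃ i₁ i₂ : BIneq L, Exhaustively ElimStep i i₁ ∧ Exhaustively DistStep i₁ i₂ ∧
    Exhaustively SplitStep {i₂} I

end Preprocessing

/-! ### Stage 2 of ALBA: reduction and elimination -/

/-- Systems `(S, Ineq)`. -/
structure System (L : Signature.{u}) : Type u where
  S : Finset (EIneq L)
  main : EIneq L

/-- The atom `x` occurs in the system. -/
def System.Occurs {L : Signature.{u}} (x : Atom) (X : System L) : Prop :=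
  (∃ i ∈ X.S, i.Occurs x) ∨ X.main.Occurs x

/-- A system is pure if no proposition letter occurs in it. -/
def System.Pure {L : Signature.{u}} (X : System L) : Prop :=
  ∀ p : ℕ, ¬ X.Occurs (.prop p)

/-- `nom j` is the first nominal that does not occur in the system. -/
def System.FirstNom {L : Signature.{u}} (X : System L) (j : ℕ) : Prop :=
  IsLeast {k : ℕ | ¬ X.Occurs (.nom k)} j

/-- `conom m` is the first co-nominal that does not occur in the system. -/
def System.FirstConom {L : Signature.{u}} (X : System L) (m : ℕ) : Prop :=
  IsLeast {k : ℕ | ¬ X.Occurs (.conom k)} m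

/-- A pivotal occurrence of the subterm `γ` in `φ(γ/!x)`, where `φ(!x)` is given by `C` and the
root has the sign `s`: the branch from `x` to the root is SLR and is maximal with this property,
that is, the root of `γ` is not an SLR node (in the sign that it inherits). -/
def Pivotal {L : Signature.{u}} {V : Type} (s : Pol) (C : Ctx L V) (γ : Term L V) : Prop :=
  C.SLR s ∧ ¬ γ.RootSLR (C.sign s)

/-- The approximation rules, restricted to pivotal applications. The term `γ` belongs to the base
language. -/
inductive PivotalApprox {L : Signature.{u}} : System L → System L → Prop
  | leftPos (S : Finset (EIneq L)) (C : Ctx L.tense Atom) (γ : BTerm L) (ψ : ETerm L) (j : ℕ)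
      (hpiv : Pivotal .pos C γ.embed) (hsign : C.sign .pos = .pos)
      (hj : System.FirstNom ⟨S, C.plug γ.embed, ψ⟩ j) :
      PivotalApprox ⟨S, C.plug γ.embed, ψ⟩
        ⟨insert ⟨.atom (.nom j), γ.embed⟩ S, C.plug (.atom (.nom j)), ψ⟩
  | leftNeg (S : Finset (EIneq L)) (C : Ctx L.tense Atom) (γ : BTerm L) (ψ : ETerm L) (m : ℕ)
      (hpiv : Pivotal .pos C γ.embed) (hsign : C.sign .pos = .neg)
      (hm : System.FirstConom ⟨S, C.plug γ.embed, ψ⟩ m) :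
      PivotalApprox ⟨S, C.plug γ.embed, ψ⟩
        ⟨insert ⟨γ.embed, .atom (.conom m)⟩ S, C.plug (.atom (.conom m)), ψ⟩
  | rightPos (S : Finset (EIneq L)) (C : Ctx L.tense Atom) (γ : BTerm L) (φ : ETerm L) (j : ℕ)
      (hpiv : Pivotal .neg C γ.embed) (hsign : C.sign .neg = .pos)
      (hj : System.FirstNom ⟨S, φ, C.plug γ.embed⟩ j) :
      PivotalApprox ⟨S, φ, C.plug γ.embed⟩
        ⟨insert ⟨.atom (.nom j), γ.embed⟩ S, φ, C.plug (.atom (.nom j))⟩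
  | rightNeg (S : Finset (EIneq L)) (C : Ctx L.tense Atom) (γ : BTerm L) (φ : ETerm L) (m : ℕ)
      (hpiv : Pivotal .neg C γ.embed) (hsign : C.sign .neg = .neg)
      (hm : System.FirstConom ⟨S, φ, C.plug γ.embed⟩ m) :
      PivotalApprox ⟨S, φ, C.plug γ.embed⟩
        ⟨insert ⟨γ.embed, .atom (.conom m)⟩ S, φ, C.plug (.atom (.conom m))⟩

/-- The residuation rules: the first inequality is rewritten to the second. -/
inductive Residuation {L : Signature.{u}} : EIneq L → EIneq L → Prop
  | fPos (f : L.F) (i : Fin (L.arF f)) (h : L.epsF f i = .pos) (φ : Fin (L.arF f) → ETerm L)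
      (ψ : ETerm L) :
      Residuation ⟨.opF (L := L.tense) (TenseF.base f) φ, ψ⟩
        ⟨φ i, .opG (L := L.tense) (TenseG.sharp f i h) (Function.update φ i ψ)⟩
  | fNeg (f : L.F) (i : Fin (L.arF f)) (h : L.epsF f i = .neg) (φ : Fin (L.arF f) → ETerm L)
      (ψ : ETerm L) :
      Residuation ⟨.opF (L := L.tense) (TenseF.base f) φ, ψ⟩
        ⟨.opF (L := L.tense) (TenseF.sharp f i h) (Function.update φ i ψ), φ i⟩
  | gPos (g : L.G) (i : Fin (L.arG g)) (h : L.epsG g i = .pos) (φ : Fin (L.arG g) → ETerm L)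
      (ψ : ETerm L) :
      Residuation ⟨ψ, .opG (L := L.tense) (TenseG.base g) φ⟩
        ⟨.opF (L := L.tense) (TenseF.flat g i h) (Function.update φ i ψ), φ i⟩
  | gNeg (g : L.G) (i : Fin (L.arG g)) (h : L.epsG g i = .neg) (φ : Fin (L.arG g) → ETerm L)
      (ψ : ETerm L) :
      Residuation ⟨ψ, .opG (L := L.tense) (TenseG.base g) φ⟩
        ⟨φ i, .opG (L := L.tense) (TenseG.flat g i h) (Function.update φ i ψ)⟩

/-- The Ackermann rules. -/
inductive Ackermann {L : Signature.{u}} : System L → System L → Prop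
  | right (p : ℕ) (αs : List (ETerm L)) (R : Finset (EIneq L)) (main : EIneq L)
      (hα : ∀ α ∈ αs, ¬ α.Occurs (.prop p)) (hmain : ¬ main.Occurs (.prop p))
      (hβ : ∀ i ∈ R, i.lhs.PositiveIn (.prop p)) (hγ : ∀ i ∈ R, i.rhs.NegativeIn (.prop p)) :
      Ackermann ⟨(αs.map fun α => (⟨α, .atom (.prop p)⟩ : EIneq L)).toFinset ∪ R, main⟩
        ⟨R.image fun i => i.subst (.prop p) (Term.bigJoin αs), main⟩
  | left (p : ℕ) (αs : List (ETerm L)) (R : Finset (EIneq L)) (main : EIneq L)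
      (hα : ∀ α ∈ αs, ¬ α.Occurs (.prop p)) (hmain : ¬ main.Occurs (.prop p))
      (hβ : ∀ i ∈ R, i.lhs.NegativeIn (.prop p)) (hγ : ∀ i ∈ R, i.rhs.PositiveIn (.prop p)) :
      Ackermann ⟨(αs.map fun α => (⟨.atom (.prop p), α⟩ : EIneq L)).toFinset ∪ R, main⟩
        ⟨R.image fun i => i.subst (.prop p) (Term.bigMeet αs), main⟩

/-- One step of a pivotal execution of the second stage of ALBA. -/
inductive PivotalStep {L : Signature.{u}} : System L → System L → Prop
  | approx (X Y : System L) (h : PivotalApprox X Y) : PivotalStep X Y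
  | residuation (S : Finset (EIneq L)) (main i j : EIneq L) (hi : i ∈ S)
      (h : Residuation i j) : PivotalStep ⟨S, main⟩ ⟨insert j (S.erase i), main⟩
  | split (S T : Finset (EIneq L)) (main : EIneq L) (h : SplitStep S T) :
      PivotalStep ⟨S, main⟩ ⟨T, main⟩
  | ackermann (X Y : System L) (h : Ackermann X Y) : PivotalStep X Y

/-- ALBA succeeds pivotally on the inequality `i`: some execution preprocesses `i` to a finite set
of inequalities and transforms each of the resulting initial systems into a pure system, all
applications of approximation rules being pivotal. -/
def ALBASucceedsPivotally {L : Signature.{u}} (i : BIneq L) : Prop :=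
  ∃ I : Finset (BIneq L), Preprocess i I ∧
    ∀ k ∈ I, ∃ Y : System L, Relation.ReflTransGen PivotalStep ⟨∅, k.embed⟩ Y ∧ Y.Pure

/-! ### Lattice expansions and canonical extensions -/

/-- An interpretation of the connectives of `L` as operations on `A`. -/
structure Ops (L : Signature.{u}) (A : Type v) where
  opF : (f : L.F) → (Fin (L.arF f) → A) → A
  opG : (g : L.G) → (Fin (L.arG g) → A) → A

/-- (Normal) lattice expansions over the bounded lattice `A`. -/
structure LatticeExpansion (L : Signature.{u}) (A : Type v) [Lattice A] [BoundedOrder A]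
    extends Ops L A where
  f_sup : ∀ f i, L.epsF f i = .pos → ∀ a x y, opF f (Function.update a i (x ⊔ y)) =
    opF f (Function.update a i x) ⊔ opF f (Function.update a i y)
  f_bot : ∀ f i, L.epsF f i = .pos → ∀ a, opF f (Function.update a i ⊥) = ⊥
  f_inf : ∀ f i, L.epsF f i = .neg → ∀ a x y, opF f (Function.update a i (x ⊓ y)) =
    opF f (Function.update a i x) ⊔ opF f (Function.update a i y)
  f_top : ∀ f i, L.epsF f i = .neg → ∀ a, opF f (Function.update a i ⊤) = ⊥
  g_inf : ∀ g i, L.epsG g i = .pos → ∀ a x y, opG g (Function.update a i (x ⊓ y)) =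
    opG g (Function.update a i x) ⊓ opG g (Function.update a i y)
  g_top : ∀ g i, L.epsG g i = .pos → ∀ a, opG g (Function.update a i ⊤) = ⊤
  g_sup : ∀ g i, L.epsG g i = .neg → ∀ a x y, opG g (Function.update a i (x ⊔ y)) =
    opG g (Function.update a i x) ⊓ opG g (Function.update a i y)
  g_bot : ∀ g i, L.epsG g i = .neg → ∀ a, opG g (Function.update a i ⊥) = ⊤

/-- The value of a term under an assignment of the atoms. -/
def Term.eval {L : Signature.{u}} {V : Type} {A : Type v} [Lattice A] [BoundedOrder A]
    (O : Ops L A) (h : V → A) : Term L V → A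
  | .atom x => h x
  | .bot => ⊥
  | .top => ⊤
  | .meet s t => s.eval O h ⊓ t.eval O h
  | .join s t => s.eval O h ⊔ t.eval O h
  | .opF f a => O.opF f fun i => (a i).eval O h
  | .opG g a => O.opG g fun i => (a i).eval O h

/-- The inequality `i` is valid in the algebra given by the operations `O`. -/
def Ops.Valid {L : Signature.{u}} {A : Type v} [Lattice A] [BoundedOrder A] (O : Ops L A)
    (i : BIneq L) : Prop :=
  ∀ h : ℕ → A, i.lhs.eval O h ≤ i.rhs.eval O h

section CanonicalExtension

variable {A : Type v} {C : Type w} [Lattice A] [BoundedOrder A] [CompleteLattice C]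

/-- The closed elements: meets of subsets of `A`. -/
def closedElts (e : BoundedLatticeHom A C) : Set C := {k | ∃ S : Set A, k = sInf (e '' S)}

/-- The open elements: joins of subsets of `A`. -/
def openElts (e : BoundedLatticeHom A C) : Set C := {o | ∃ S : Set A, o = sSup (e '' S)}

/-- The complete lattice `C` together with the embedding `e` is a canonical extension of the
bounded lattice `A`. -/
structure IsCanonicalExtension (e : BoundedLatticeHom A C) : Prop where
  injective : Function.Injective e
  join_of_meets : ∀ u : C, ∃ X : Set C, X ⊆ closedElts e ∧ u = sSup X
  meet_of_joins : ∀ u : C, ∃ X : Set C, X ⊆ openElts e ∧ u = sInf X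
  compact : ∀ S T : Set A, sInf (e '' S) ≤ sSup (e '' T) →
    ∃ S' T' : Set A, S' ⊆ S ∧ T' ⊆ T ∧ S'.Finite ∧ T'.Finite ∧ sInf (e '' S') ≤ sSup (e '' T')

/-- The product order `x ≤^ε y`: it is `x i ≤ y i` if `ε i = 1`, and `y i ≤ x i` if `ε i = ∂`. -/
def PolLE {n : ℕ} (ε : Fin n → Pol) (x y : Fin n → C) : Prop :=
  ∀ i, match ε i with
    | .pos => x i ≤ y i
    | .neg => y i ≤ x i

/-- The tuples in `K^ε`: closed where `ε i = 1`, open where `ε i = ∂`. -/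
def PolClosed (e : BoundedLatticeHom A C) {n : ℕ} (ε : Fin n → Pol) (k : Fin n → C) : Prop :=
  ∀ i, match ε i with
    | .pos => k i ∈ closedElts e
    | .neg => k i ∈ openElts e

/-- The tuples in `O^ε`: open where `ε i = 1`, closed where `ε i = ∂`. -/
def PolOpen (e : BoundedLatticeHom A C) {n : ℕ} (ε : Fin n → Pol) (o : Fin n → C) : Prop :=
  ∀ i, match ε i with
    | .pos => o i ∈ openElts e
    | .neg => o i ∈ closedElts e

/-- The `σ`-extension of an `ε`-monotone operation, on tuples from `K^ε`. -/
def sigmaClosed (e : BoundedLatticeHom A C) {n : ℕ} (ε : Fin n → Pol) (f : (Fin n → A) → A)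
    (k : Fin n → C) : C :=
  sInf {c | ∃ a : Fin n → A, PolLE ε k (fun i => e (a i)) ∧ c = e (f a)}

/-- The `σ`-extension of an `ε`-monotone operation. -/
def sigmaExt (e : BoundedLatticeHom A C) {n : ℕ} (ε : Fin n → Pol) (f : (Fin n → A) → A)
    (u : Fin n → C) : C :=
  sSup {c | ∃ k : Fin n → C, PolClosed e ε k ∧ PolLE ε k u ∧ c = sigmaClosed e ε f k}

/-- The `π`-extension of an `ε`-monotone operation, on tuples from `O^ε`. -/
def piOpen (e : BoundedLatticeHom A C) {n : ℕ} (ε : Fin n → Pol) (g : (Fin n → A) → A)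
    (o : Fin n → C) : C :=
  sSup {c | ∃ a : Fin n → A, PolLE ε (fun i => e (a i)) o ∧ c = e (g a)}

/-- The `π`-extension of an `ε`-monotone operation. -/
def piExt (e : BoundedLatticeHom A C) {n : ℕ} (ε : Fin n → Pol) (g : (Fin n → A) → A)
    (u : Fin n → C) : C :=
  sInf {c | ∃ o : Fin n → C, PolOpen e ε o ∧ PolLE ε u o ∧ c = piOpen e ε g o}

/-- The operations of the canonical extension `A^δ` of a lattice expansion: the `σ`-extensions of
the operations in `F` and the `π`-extensions of the operations in `G`. -/
def LatticeExpansion.canonicalExtension {L : Signature.{u}} (𝔸 : LatticeExpansion L A)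
    (e : BoundedLatticeHom A C) : Ops L C where
  opF f := sigmaExt e (L.epsF f) (𝔸.opF f)
  opG g := piExt e (L.epsG g) (𝔸.opG g)

end CanonicalExtension

end LatExp

/-! The proof is a U-shaped argument. Elements of `A` are identified with their images in `C`.
Validity in `𝔸` is validity in the canonical extension restricted to assignments with proposition
letters in `A`. The reduction carries this restricted validity down to a pure system. A pure system
cannot distinguish such assignments from arbitrary ones, and validity under all assignments is
carried back up to the original inequality. Each rule is therefore needed in one direction for
assignments in `A` and in the other for all assignments (`SoundStep`).

Nominals range over all closed elements and co-nominals over all open elements; no join-irreducible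
elements are required. Approximation is sound because closed elements are join-dense, open elements
are meet-dense, and a branch of SLR nodes preserves arbitrary joins up to sign. This rests on
`signedExt_isCompleteOperator`: the σ-extension of an operator preserves all joins in each
coordinate, up to order type, and dually for π-extensions. The same lemma makes the residuals exist,
which gives residuation.

The hard step is Ackermann's rule for assignments in `A`: the eliminated letter must receive a value
in `A`, whereas the minimal solution is only closed (or open). The invariant is that left-hand sides
are syntactically closed and right-hand sides syntactically open. Such terms take closed,
respectively open, values. By `Term.SynClosed.approximates` they also behave continuously when a
closed value of `p` is approximated from above by elements of `A`. Compactness puts an element of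
`A` between the two sides of each inequality, and one sufficiently close approximant then works for
all the finitely many inequalities. The continuity is proved by induction on terms from
`Interpolates`. Basic connectives have this property at both signs; a residual inherits it from its
operation at one sign (`interpolates_residual`).

Everything is stated relative to a sign `s`, which selects an order or its dual. Thus `signedExt`
covers both σ- and π-extensions, and dual rules share one proof. -/

namespace LatExp

open Function

/-! ### Lattices up to a sign -/

namespace Pol

@[simp] theorem op_op (s : Pol) : s.op.op = s := by cases s <;> rfl

theorem through_op (s ε : Pol) : s.op.through ε = (s.through ε).op := by
  cases s <;> cases ε <;> rfl

section Order

variable {A : Type*}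

/-- The order of `A` for the sign `+`, and its dual for the sign `-`. -/
def le [LE A] : Pol → A → A → Prop
  | pos, x, y => x ≤ y
  | neg, x, y => y ≤ x

@[simp] theorem le_op [LE A] {s : Pol} {x y : A} : s.op.le x y ↔ s.le y x := by
  cases s <;> rfl

theorem le_refl [Preorder A] (s : Pol) (x : A) : s.le x x := by
  cases s <;> exact _root_.le_refl x

theorem le_trans [Preorder A] {s : Pol} {x y z : A} (h : s.le x y) (h' : s.le y z) :
    s.le x z := by
  cases s
  · exact _root_.le_trans h h'
  · exact _root_.le_trans h' h

theorem le_antisymm [PartialOrder A] {s : Pol} {x y : A} (h : s.le x y) (h' : s.le y x) :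
    x = y := by
  cases s
  · exact _root_.le_antisymm h h'
  · exact _root_.le_antisymm h' h

/-- The binary join for the sign `+`, the binary meet for the sign `-`. -/
def sup [Lattice A] : Pol → A → A → A
  | pos, x, y => x ⊔ y
  | neg, x, y => x ⊓ y

/-- The least element for the sign `+`, the greatest element for the sign `-`. -/
def bot [LE A] [BoundedOrder A] : Pol → A
  | pos => ⊥
  | neg => ⊤

theorem bot_le [LE A] [BoundedOrder A] (s : Pol) (x : A) : s.le s.bot x := by
  cases s
  · exact _root_.bot_le (a := x)
  · exact _root_.le_top (a := x)

theorem le_top [LE A] [BoundedOrder A] (s : Pol) (x : A) : s.le x s.op.bot := by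
  rw [← le_op]; exact bot_le _ x

theorem le_sup_left [Lattice A] (s : Pol) (x y : A) : s.le x (s.sup x y) := by
  cases s
  · exact _root_.le_sup_left
  · exact _root_.inf_le_left

theorem le_sup_right [Lattice A] (s : Pol) (x y : A) : s.le y (s.sup x y) := by
  cases s
  · exact _root_.le_sup_right
  · exact _root_.inf_le_right

theorem sup_le [Lattice A] {s : Pol} {x y z : A} (hx : s.le x z) (hy : s.le y z) :
    s.le (s.sup x y) z := by
  cases s
  · exact _root_.sup_le hx hy
  · exact _root_.le_inf hx hy

theorem sup_eq_right [Lattice A] {s : Pol} {x y : A} (h : s.le x y) : s.sup x y = y :=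
  le_antisymm (sup_le h (le_refl s y)) (le_sup_right s x y)

theorem sup_mono [Lattice A] {s : Pol} {x y x' y' : A} (h : s.le x x') (h' : s.le y y') :
    s.le (s.sup x y) (s.sup x' y') :=
  sup_le (le_trans h (le_sup_left s x' y')) (le_trans h' (le_sup_right s x' y'))

theorem op_sup_le_left [Lattice A] (s : Pol) (x y : A) : s.le (s.op.sup x y) x :=
  le_op.1 (le_sup_left s.op x y)

theorem op_sup_le_right [Lattice A] (s : Pol) (x y : A) : s.le (s.op.sup x y) y :=
  le_op.1 (le_sup_right s.op x y)

theorem le_op_sup [Lattice A] {s : Pol} {x y z : A} (hx : s.le z x) (hy : s.le z y) :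
    s.le z (s.op.sup x y) :=
  le_op.1 (sup_le (le_op.2 hx) (le_op.2 hy))

/-- The join of a set for the sign `+`, the meet for the sign `-`. -/
def sSup [CompleteLattice A] : Pol → Set A → A
  | pos, X => SupSet.sSup X
  | neg, X => InfSet.sInf X

theorem le_sSup [CompleteLattice A] {s : Pol} {X : Set A} {x : A} (hx : x ∈ X) :
    s.le x (s.sSup X) := by
  cases s
  · exact _root_.le_sSup hx
  · exact _root_.sInf_le hx

theorem sSup_le [CompleteLattice A] {s : Pol} {X : Set A} {y : A} (h : ∀ x ∈ X, s.le x y) :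
    s.le (s.sSup X) y := by
  cases s
  · exact _root_.sSup_le h
  · exact _root_.le_sInf h

theorem sSup_mono [CompleteLattice A] {s : Pol} {X Y : Set A} (h : X ⊆ Y) :
    s.le (s.sSup X) (s.sSup Y) :=
  sSup_le fun _ hx => le_sSup (h hx)

end Order

end Pol

/-! ### Operators -/

section Operator

variable {A : Type v} {n : ℕ}

/-- `h` is monotone in the order of sign `σ i` in the `i`-th coordinate and the order of sign `s`
on values. -/
def SignedMonotone [LE A] (s : Pol) (σ : Fin n → Pol) (h : (Fin n → A) → A) : Prop :=
  ∀ a b, (∀ i, (σ i).le (a i) (b i)) → s.le (h a) (h b)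

/-- `h` sends the finite joins of sign `σ i` in the `i`-th coordinate to finite joins of
sign `s`. -/
structure IsOperator [Lattice A] [BoundedOrder A] (s : Pol) (σ : Fin n → Pol)
    (h : (Fin n → A) → A) : Prop where
  map_sup : ∀ i a x y, h (update a i ((σ i).sup x y)) =
    s.sup (h (update a i x)) (h (update a i y))
  map_bot : ∀ i a, h (update a i (σ i).bot) = s.bot

/-- The coordinates of `a` are replaced by those of `b` one at a time. A single replacement is
monotone because `x ≤ y` means `x ⊔ y = y`, and binary joins in that coordinate are preserved. -/
theorem IsOperator.mono [Lattice A] [BoundedOrder A] {s : Pol} {σ : Fin n → Pol}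
    {h : (Fin n → A) → A} (hh : IsOperator s σ h) : SignedMonotone s σ h := by
  intro a b hab
  have key : ∀ T : Finset (Fin n), s.le (h a) (h (T.piecewise b a)) := by
    intro T
    induction T using Finset.induction_on with
    | empty => simpa using Pol.le_refl s (h a)
    | insert j T hj ih =>
      refine Pol.le_trans ih ?_
      rw [Finset.piecewise_insert]
      have hs := hh.map_sup j (T.piecewise b a) (a j) (b j)
      rw [Pol.sup_eq_right (hab j)] at hs
      rw [hs]
      have he : update (T.piecewise b a) j (a j) = T.piecewise b a := by
        rw [update_eq_self_iff]; simp [hj]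
      rw [he]
      exact Pol.le_sup_left _ _ _
  simpa using key Finset.univ

end Operator

/-! ### Closed and open elements -/

section Canonical

variable {A : Type v} {C : Type w} [Lattice A] [BoundedOrder A] [CompleteLattice C]
  {e : BoundedLatticeHom A C} {n : ℕ}

/-- The closed elements for the sign `+`, the open elements for the sign `-`. -/
def signedClosed (e : BoundedLatticeHom A C) : Pol → Set C
  | .pos => closedElts e
  | .neg => openElts e

theorem map_signed_sup (e : BoundedLatticeHom A C) (s : Pol) (a b : A) :
    e (s.sup a b) = s.sup (e a) (e b) := by
  cases s
  · exact map_sup e a b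
  · exact map_inf e a b

theorem map_signed_bot (e : BoundedLatticeHom A C) (s : Pol) : e s.bot = s.bot := by
  cases s
  · exact map_bot e
  · exact map_top e

theorem map_signed_le (e : BoundedLatticeHom A C) {s : Pol} {a b : A} (h : s.le a b) :
    s.le (e a) (e b) := by
  cases s
  · exact OrderHomClass.mono e h
  · exact OrderHomClass.mono e h

theorem map_mem_signedClosed (e : BoundedLatticeHom A C) (s : Pol) (a : A) :
    e a ∈ signedClosed e s := by
  cases s
  · exact ⟨{a}, by simp⟩
  · exact ⟨{a}, by simp⟩

/-- An element is closed if it is the meet of the elements of `A` above it. -/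
theorem mem_signedClosed_of_le {s : Pol} {x : C}
    (h : s.le (s.op.sSup (e '' {a | s.le x (e a)})) x) : x ∈ signedClosed e s := by
  have h' : s.le x (s.op.sSup (e '' {a | s.le x (e a)})) := by
    rw [← Pol.le_op]
    refine Pol.sSup_le ?_
    rintro _ ⟨a, ha, rfl⟩
    exact Pol.le_op.2 ha
  cases s
  · exact ⟨_, Pol.le_antisymm h' h⟩
  · exact ⟨_, Pol.le_antisymm h' h⟩

theorem signedClosed_meet_le {s : Pol} {k : C} (hk : k ∈ signedClosed e s) :
    s.le (s.op.sSup (e '' {a | s.le k (e a)})) k := by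
  cases s
  · obtain ⟨S, rfl⟩ := hk
    refine _root_.sInf_le_sInf (Set.image_mono fun a ha => ?_)
    exact _root_.sInf_le ⟨a, ha, rfl⟩
  · obtain ⟨S, rfl⟩ := hk
    refine _root_.sSup_le_sSup (Set.image_mono fun a ha => ?_)
    exact _root_.le_sSup ⟨a, ha, rfl⟩

namespace IsCanonicalExtension

variable (he : IsCanonicalExtension e)
include he

/-- Denseness: an element is the join of the closed elements below it. -/
theorem le_of_closed {s : Pol} {u y : C}
    (h : ∀ c ∈ signedClosed e s, s.le c u → s.le c y) : s.le u y := by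
  cases s
  · obtain ⟨X, hX, rfl⟩ := he.join_of_meets u
    exact _root_.sSup_le fun c hc => h c (hX hc) (_root_.le_sSup hc)
  · obtain ⟨X, hX, rfl⟩ := he.meet_of_joins u
    exact _root_.le_sInf fun c hc => h c (hX hc) (_root_.sInf_le hc)

theorem le_of_open {s : Pol} {u y : C}
    (h : ∀ o ∈ signedClosed e s.op, s.le y o → s.le u o) : s.le u y := by
  rw [← Pol.le_op]
  refine he.le_of_closed fun o ho hy => ?_
  exact Pol.le_op.2 (h o ho (Pol.le_op.1 hy))

end IsCanonicalExtension

/-- This replaces the finite subset delivered by compactness by a single element of the directed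
set. -/
theorem exists_upper_bound_of_directed {A : Type*} [Preorder A] {s : Pol} {D : Set A} (hne : D.Nonempty)
    (hdir : ∀ a ∈ D, ∀ b ∈ D, ∃ c ∈ D, s.le a c ∧ s.le b c) {F : Set A} (hF : F.Finite) :
    F ⊆ D → ∃ d ∈ D, ∀ x ∈ F, s.le x d := by
  induction F, hF using Set.Finite.induction_on with
  | empty =>
    obtain ⟨d, hd⟩ := hne
    exact fun _ => ⟨d, hd, by simp⟩
  | @insert a F _ _ ih =>
    intro hFD
    obtain ⟨d, hd, hdF⟩ := ih fun x hx => hFD (Set.mem_insert_of_mem a hx)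
    obtain ⟨c, hc, hac, hdc⟩ := hdir a (hFD (Set.mem_insert a F)) d hd
    refine ⟨c, hc, fun x hx => ?_⟩
    rcases hx with rfl | hx
    · exact hac
    · exact Pol.le_trans (hdF x hx) hdc

namespace IsCanonicalExtension

variable (he : IsCanonicalExtension e)
include he

/-- Compactness with respect to directed subsets of `A`. -/
theorem exists_le_of_directed {s : Pol} {k : C} (hk : k ∈ signedClosed e s) {D : Set A}
    (hne : D.Nonempty) (hdir : ∀ a ∈ D, ∀ b ∈ D, ∃ c ∈ D, s.le a c ∧ s.le b c)
    (h : s.le k (s.sSup (e '' D))) : ∃ d ∈ D, s.le k (e d) := by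
  cases s
  · obtain ⟨S, rfl⟩ := hk
    obtain ⟨S', T', hS, hT, -, hTf, hle⟩ := he.compact S D h
    obtain ⟨d, hd, hub⟩ := exists_upper_bound_of_directed hne hdir hTf hT
    refine ⟨d, hd, _root_.le_trans (_root_.sInf_le_sInf (Set.image_mono hS))
      (_root_.le_trans hle (_root_.sSup_le ?_))⟩
    rintro _ ⟨a, ha, rfl⟩
    exact OrderHomClass.mono e (hub a ha)
  · obtain ⟨T, rfl⟩ := hk
    obtain ⟨S', T', hS, hT, hSf, -, hle⟩ := he.compact D T h
    obtain ⟨d, hd, hub⟩ := exists_upper_bound_of_directed hne hdir hSf hS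
    refine ⟨d, hd, _root_.le_trans (_root_.le_trans (_root_.le_sInf ?_) hle)
      (_root_.sSup_le_sSup (Set.image_mono hT))⟩
    rintro _ ⟨a, ha, rfl⟩
    exact OrderHomClass.mono e (hub a ha)

/-- An open element is the directed join of the elements of `A` below it, so compactness selects one
of them above `k`. -/
theorem exists_between {s : Pol} {k o : C} (hk : k ∈ signedClosed e s)
    (ho : o ∈ signedClosed e s.op) (h : s.le k o) : ∃ a : A, s.le k (e a) ∧ s.le (e a) o := by
  have h₁ := signedClosed_meet_le ho
  simp only [Pol.op_op, Pol.le_op] at h₁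
  obtain ⟨a, ha, hka⟩ := he.exists_le_of_directed hk (D := {a | s.le (e a) o})
    ⟨s.bot, by rw [Set.mem_ofPred_eq, map_signed_bot]; exact Pol.bot_le s o⟩
    (fun a ha b hb => ⟨s.sup a b, by
      rw [Set.mem_ofPred_eq, map_signed_sup]; exact Pol.sup_le ha hb,
      Pol.le_sup_left s a b, Pol.le_sup_right s a b⟩) (Pol.le_trans h h₁)
  exact ⟨a, hka, ha⟩

/-- Converse to interpolation by elements of `A`: since `x` is the meet of the open elements above
it, the interpolants already have meet `x`. -/
theorem mem_signedClosed {s : Pol} {x : C}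
    (h : ∀ o ∈ signedClosed e s.op, s.le x o → ∃ a : A, s.le x (e a) ∧ s.le (e a) o) :
    x ∈ signedClosed e s := by
  refine mem_signedClosed_of_le (he.le_of_open fun o ho hxo => ?_)
  obtain ⟨a, hxa, hao⟩ := h o ho hxo
  refine Pol.le_trans ?_ hao
  rw [← Pol.le_op]
  exact Pol.le_sSup ⟨a, hxa, rfl⟩

end IsCanonicalExtension

/-! ### Extensions of operators -/

/-- The meet of the values of `h` on the tuples of `A` above `k`, all up to signs. -/
def signedExtClosed (e : BoundedLatticeHom A C) (s : Pol) (σ : Fin n → Pol)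
    (h : (Fin n → A) → A) (k : Fin n → C) : C :=
  s.op.sSup (e '' {b | ∃ a : Fin n → A, (∀ i, (σ i).le (k i) (e (a i))) ∧ h a = b})

/-- The `σ`-extension and the `π`-extension up to signs. -/
def signedExt (e : BoundedLatticeHom A C) (s : Pol) (σ : Fin n → Pol)
    (h : (Fin n → A) → A) (u : Fin n → C) : C :=
  s.sSup {c | ∃ k : Fin n → C, (∀ i, k i ∈ signedClosed e (σ i)) ∧
    (∀ i, (σ i).le (k i) (u i)) ∧ c = signedExtClosed e s σ h k}

theorem polLE_iff {ε : Fin n → Pol} {x y : Fin n → C} :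
    PolLE ε x y ↔ ∀ i, (ε i).le (x i) (y i) := by
  refine forall_congr' fun i => ?_
  cases ε i <;> exact Iff.rfl

theorem polClosed_iff {ε : Fin n → Pol} {k : Fin n → C} :
    PolClosed e ε k ↔ ∀ i, k i ∈ signedClosed e (ε i) := by
  refine forall_congr' fun i => ?_
  cases ε i <;> exact Iff.rfl

theorem polOpen_iff {ε : Fin n → Pol} {o : Fin n → C} :
    PolOpen e ε o ↔ ∀ i, o i ∈ signedClosed e (ε i).op := by
  refine forall_congr' fun i => ?_
  cases ε i <;> exact Iff.rfl

theorem sigmaExt_eq (ε : Fin n → Pol) (f : (Fin n → A) → A) :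
    sigmaExt e ε f = signedExt e .pos (fun i => Pol.pos.through (ε i)) f := by
  have hε : (fun i => Pol.pos.through (ε i)) = ε := by
    funext i; cases ε i <;> rfl
  rw [hε]
  funext u
  have hc : ∀ k, sigmaClosed e ε f k = signedExtClosed e .pos ε f k := by
    intro k
    refine congrArg InfSet.sInf (Set.ext fun c => ?_)
    simp only [polLE_iff, Set.mem_image, Set.mem_ofPred_eq]
    constructor
    · rintro ⟨a, ha, rfl⟩; exact ⟨_, ⟨a, ha, rfl⟩, rfl⟩
    · rintro ⟨_, ⟨a, ha, rfl⟩, rfl⟩; exact ⟨a, ha, rfl⟩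
  simp only [sigmaExt, signedExt, polLE_iff, polClosed_iff, hc, Pol.sSup]

/-- With root sign `-`, the coordinate signs are all opposite to the order type. This exchanges
closed with open tuples and meets with joins, so the π-extension becomes the same signed
construction. -/
theorem piExt_eq (ε : Fin n → Pol) (g : (Fin n → A) → A) :
    piExt e ε g = signedExt e .neg (fun i => Pol.neg.through (ε i)) g := by
  have hε : (fun i => Pol.neg.through (ε i)) = fun i => (ε i).op := by
    funext i; cases ε i <;> rfl
  rw [hε]
  funext u
  have hc : ∀ k, piOpen e ε g k = signedExtClosed e .neg (fun i => (ε i).op) g k := by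
    intro k
    refine congrArg SupSet.sSup (Set.ext fun c => ?_)
    simp only [polLE_iff, Set.mem_image, Set.mem_ofPred_eq, Pol.le_op]
    constructor
    · rintro ⟨a, ha, rfl⟩; exact ⟨_, ⟨a, ha, rfl⟩, rfl⟩
    · rintro ⟨_, ⟨a, ha, rfl⟩, rfl⟩; exact ⟨a, ha, rfl⟩
  simp only [piExt, signedExt, polLE_iff, polOpen_iff, hc, Pol.sSup, Pol.le_op]

/-- On closed tuples, `H` is approximated from above by its values on tuples of `A`, all up to
signs. -/
def Interpolates (e : BoundedLatticeHom A C) (s : Pol) (σ : Fin n → Pol)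
    (H : (Fin n → C) → C) : Prop :=
  ∀ k : Fin n → C, (∀ i, k i ∈ signedClosed e (σ i)) → ∀ o ∈ signedClosed e s.op,
    s.le (H k) o → ∃ (a : Fin n → A) (b : A), (∀ i, (σ i).le (k i) (e (a i))) ∧
      s.le (H fun i => e (a i)) (e b) ∧ s.le (e b) o

/-- `H` sends the joins of sign `σ i` in the `i`-th coordinate to joins of sign `s`. -/
structure IsCompleteOperator (s : Pol) (σ : Fin n → Pol) (H : (Fin n → C) → C) : Prop where
  mono : SignedMonotone s σ H
  sSup_le : ∀ i u X y, (∀ x ∈ X, s.le (H (update u i x)) y) →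
    s.le (H (update u i ((σ i).sSup X))) y

theorem SignedMonotone.update {s : Pol} {σ : Fin n → Pol} {X : Type*} [Preorder X]
    {H : (Fin n → X) → X} (hH : SignedMonotone s σ H) {u : Fin n → X} {i : Fin n} {x y : X}
    (h : (σ i).le x y) : s.le (H (update u i x)) (H (update u i y)) := by
  refine hH _ _ fun j => ?_
  rcases eq_or_ne j i with rfl | hj
  · simpa using h
  · simpa [hj] using Pol.le_refl _ _

section Ext

variable {s : Pol} {σ : Fin n → Pol} {h : (Fin n → A) → A}

theorem signedExt_mono : SignedMonotone s σ (signedExt e s σ h) := by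
  refine fun u v huv => Pol.sSup_mono ?_
  rintro _ ⟨k, hk, hku, rfl⟩
  exact ⟨k, hk, fun i => Pol.le_trans (hku i) (huv i), rfl⟩

theorem signedExtClosed_le {k : Fin n → C} {a : Fin n → A}
    (hka : ∀ i, (σ i).le (k i) (e (a i))) : s.le (signedExtClosed e s σ h k) (e (h a)) := by
  rw [← Pol.le_op]
  exact Pol.le_sSup ⟨_, ⟨a, hka, rfl⟩, rfl⟩

theorem signedExtClosed_le_signedExt {k u : Fin n → C}
    (hk : ∀ i, k i ∈ signedClosed e (σ i)) (hku : ∀ i, (σ i).le (k i) (u i)) :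
    s.le (signedExtClosed e s σ h k) (signedExt e s σ h u) :=
  Pol.le_sSup ⟨k, hk, hku, rfl⟩

variable (hh : IsOperator s σ h)
include hh

theorem signedExt_map (he : IsCanonicalExtension e) (a : Fin n → A) :
    signedExt e s σ h (fun i => e (a i)) = e (h a) := by
  refine Pol.le_antisymm (s := s) (Pol.sSup_le ?_) ?_
  · rintro _ ⟨k, -, hka, rfl⟩
    exact signedExtClosed_le hka
  · refine Pol.le_trans ?_ (Pol.le_sSup ⟨fun i => e (a i),
      fun i => map_mem_signedClosed e _ _, fun i => Pol.le_refl _ _, rfl⟩)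
    rw [← Pol.le_op]
    refine Pol.sSup_le ?_
    rintro _ ⟨_, ⟨b, hb, rfl⟩, rfl⟩
    rw [Pol.le_op]
    refine map_signed_le e (hh.mono _ _ fun i => ?_)
    -- `e` reflects the order because it is injective and the order is expressed by an equation
    -- between joins.
    have key : ∀ {t : Pol} {x y : A}, t.le (e x) (e y) → t.le x y := by
      intro t x y hxy
      have h' := Pol.sup_eq_right hxy
      rw [← map_signed_sup] at h'
      rw [← he.injective h']
      exact Pol.le_sup_left _ _ _
    exact key (hb i)

/-- The values over which the meet is taken form a down-directed set: the coordinatewise meet of two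
tuples above `k` is again above `k`, and `h` is monotone. Compactness against the open bound then
leaves a single tuple. -/
theorem signedExtClosed_interpolates (he : IsCanonicalExtension e) (k : Fin n → C)
    {o : C} (ho : o ∈ signedClosed e s.op) (hko : s.le (signedExtClosed e s σ h k) o) :
    ∃ a : Fin n → A, (∀ i, (σ i).le (k i) (e (a i))) ∧ s.le (e (h a)) o := by
  rw [← Pol.le_op] at hko
  obtain ⟨_, ⟨a, ha, rfl⟩, hoa⟩ := he.exists_le_of_directed ho
    (D := {b | ∃ a : Fin n → A, (∀ i, (σ i).le (k i) (e (a i))) ∧ h a = b})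
    ⟨_, fun i => (σ i).op.bot, fun i => by
      rw [map_signed_bot]; exact Pol.le_top _ _, rfl⟩ (by
      rintro _ ⟨a, ha, rfl⟩ _ ⟨b, hb, rfl⟩
      refine ⟨_, ⟨fun i => (σ i).op.sup (a i) (b i), fun i => ?_, rfl⟩, ?_, ?_⟩
      · rw [map_signed_sup]; exact Pol.le_op_sup (ha i) (hb i)
      · exact Pol.le_op.2 (hh.mono _ _ fun i => Pol.op_sup_le_left _ _ _)
      · exact Pol.le_op.2 (hh.mono _ _ fun i => Pol.op_sup_le_right _ _ _)) hko
  exact ⟨a, ha, Pol.le_op.1 hoa⟩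

theorem signedExt_interpolates (he : IsCanonicalExtension e) :
    Interpolates e s σ (signedExt e s σ h) := by
  intro k hk o ho hko
  obtain ⟨a, ha, hao⟩ := signedExtClosed_interpolates hh he k ho
    (Pol.le_trans (signedExtClosed_le_signedExt hk fun i => Pol.le_refl _ _) hko)
  refine ⟨a, h a, ha, ?_, hao⟩
  rw [signedExt_map hh he]
  exact Pol.le_refl _ _

/-- The extension is also determined by `A` on open tuples. Between a closed tuple and an open tuple
above it lies a tuple of `A`, so the value at an open tuple is the directed join of the values at
the tuples of `A` below it. -/
theorem signedExt_interpolates_op (he : IsCanonicalExtension e) :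
    Interpolates e s.op (fun i => (σ i).op) (signedExt e s σ h) := by
  intro o ho k hk hko
  rw [Pol.op_op] at hk
  rw [Pol.le_op] at hko
  have hle : s.le (signedExt e s σ h o)
      (s.sSup (e '' {b | ∃ a : Fin n → A, (∀ i, (σ i).le (e (a i)) (o i)) ∧ h a = b})) := by
    refine Pol.sSup_le ?_
    rintro _ ⟨c, hc, hco, rfl⟩
    choose a hca hao using fun i => he.exists_between (hc i) (ho i) (hco i)
    exact Pol.le_trans (signedExtClosed_le hca) (Pol.le_sSup ⟨_, ⟨a, hao, rfl⟩, rfl⟩)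
  obtain ⟨_, ⟨a, ha, rfl⟩, hka⟩ := he.exists_le_of_directed hk
    (D := {b | ∃ a : Fin n → A, (∀ i, (σ i).le (e (a i)) (o i)) ∧ h a = b})
    ⟨_, fun i => (σ i).bot, fun i => by
      rw [map_signed_bot]; exact Pol.bot_le _ _, rfl⟩ (by
      rintro _ ⟨a, ha, rfl⟩ _ ⟨b, hb, rfl⟩
      refine ⟨_, ⟨fun i => (σ i).sup (a i) (b i), fun i => ?_, rfl⟩, ?_, ?_⟩
      · rw [map_signed_sup]; exact Pol.sup_le (ha i) (hb i)
      · exact hh.mono _ _ fun i => Pol.le_sup_left _ _ _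
      · exact hh.mono _ _ fun i => Pol.le_sup_right _ _ _) (Pol.le_trans hko hle)
  refine ⟨a, h a, fun i => Pol.le_op.2 (ha i), ?_, Pol.le_op.2 hka⟩
  rw [signedExt_map hh he]
  exact Pol.le_refl _ _

theorem signedExt_isCompleteOperator (he : IsCanonicalExtension e) :
    IsCompleteOperator s σ (signedExt e s σ h) := by
  -- By denseness the bound `y` may be replaced by an open `o` above it, and the value at the join
  -- is tested on the closed tuples `k` below the argument.
  refine ⟨signedExt_mono, fun i u X y hX => he.le_of_open fun o ho hyo => Pol.sSup_le ?_⟩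
  rintro _ ⟨k, hk, hku, rfl⟩
  have hku' : ∀ j, j ≠ i → (σ j).le (k j) (u j) := fun j hj => by simpa [hj] using hku j
  have hki : (σ i).le (k i) ((σ i).sSup X) := by simpa using hku i
  -- `D` collects the admissible entries in coordinate `i`, the other coordinates being
  -- approximations of `k` from above. It is directed because `h` preserves binary joins in
  -- coordinate `i`, and it contains the least element because `h` preserves the empty join.
  set D : Set A := {b | ∃ a : Fin n → A, (∀ j, j ≠ i → (σ j).le (k j) (e (a j))) ∧
    s.le (e (h (update a i b))) o}
  -- Each closed `c` below a member of `X` gives a tuple `update k i c` whose value is below `o`;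
  -- interpolation yields an element of `D` above `c`.
  have hXD : (σ i).le ((σ i).sSup X) ((σ i).sSup (e '' D)) := by
    refine Pol.sSup_le fun x hx => he.le_of_closed fun c hc hcx => ?_
    have hkc : ∀ j, update k i c j ∈ signedClosed e (σ j) := fun j => by
      rcases eq_or_ne j i with rfl | hj
      · simpa using hc
      · simpa [hj] using hk j
    obtain ⟨a, hka, hao⟩ := signedExtClosed_interpolates hh he (update k i c) ho <| by
      refine Pol.le_trans (signedExtClosed_le_signedExt hkc fun j => ?_)
        (Pol.le_trans (hX x hx) hyo)
      rcases eq_or_ne j i with rfl | hj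
      · simpa using hcx
      · simpa [hj] using hku' j hj
    have hci : (σ i).le c (e (a i)) := by simpa using hka i
    refine Pol.le_trans hci (Pol.le_sSup ⟨a i, ⟨a, fun j hj => ?_, ?_⟩, rfl⟩)
    · simpa [hj] using hka j
    · simpa using hao
  -- Compactness replaces the join of `D` by one entry `b` above `k i`, and `update a i b` then
  -- witnesses the bound on the value at `k`.
  obtain ⟨b, ⟨a, ha, hao⟩, hkb⟩ := he.exists_le_of_directed (hk i) (D := D)
    ⟨(σ i).bot, fun j => (σ j).op.bot, fun j _ => by
      rw [map_signed_bot]; exact Pol.le_top _ _, by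
      rw [hh.map_bot, map_signed_bot]; exact Pol.bot_le _ _⟩ (by
      rintro x ⟨a, ha, hax⟩ y ⟨b, hb, hby⟩
      refine ⟨(σ i).sup x y, ⟨fun j => (σ j).op.sup (a j) (b j), fun j hj => ?_, ?_⟩,
        Pol.le_sup_left _ _ _, Pol.le_sup_right _ _ _⟩
      · rw [map_signed_sup]; exact Pol.le_op_sup (ha j hj) (hb j hj)
      · rw [hh.map_sup, map_signed_sup]
        refine Pol.sup_le (Pol.le_trans (map_signed_le e (hh.mono _ _ fun j => ?_)) hax)
          (Pol.le_trans (map_signed_le e (hh.mono _ _ fun j => ?_)) hby)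
        all_goals
          rcases eq_or_ne j i with rfl | hj
          · simpa using Pol.le_refl _ _
          · simp only [update_of_ne hj]
            first
              | exact Pol.op_sup_le_left _ _ _
              | exact Pol.op_sup_le_right _ _ _) (Pol.le_trans hki hXD)
  refine Pol.le_trans (signedExtClosed_le (a := update a i b) fun j => ?_) hao
  rcases eq_or_ne j i with rfl | hj
  · simpa using hkb
  · simpa [hj] using ha j hj

end Ext

/-! ### Residuals -/

/-- The residual of `H` in the `i`-th coordinate; the value of the `i`-th argument is the bound
on the values of `H`. -/
def residual (s : Pol) (σ : Fin n → Pol) (H : (Fin n → C) → C) (i : Fin n) (u : Fin n → C) : C :=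
  (σ i).sSup {x | s.le (H (update u i x)) (u i)}

section Residual

variable {s : Pol} {σ : Fin n → Pol} {H : (Fin n → C) → C}

namespace IsCompleteOperator

variable (hH : IsCompleteOperator s σ H)
include hH

/-- The set of solutions `x` is closed under joins since `H` preserves them, so its join is itself a
solution. -/
theorem le_residual_iff {i : Fin n} {u : Fin n → C} {x : C} :
    (σ i).le x (residual s σ H i u) ↔ s.le (H (update u i x)) (u i) := by
  constructor
  · intro h
    exact Pol.le_trans (hH.mono.update h) (hH.sSup_le _ _ _ _ fun y hy => hy)
  · exact fun h => Pol.le_sSup h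

theorem le_iff_le_residual {i : Fin n} {u : Fin n → C} {y : C} :
    s.le (H u) y ↔ (σ i).le (u i) (residual s σ H i (update u i y)) := by
  rw [hH.le_residual_iff]; simp

/-- Both claims are read off the adjunction. In coordinate `i` the residual turns meets of bounds
into meets, as any right adjoint does; in another coordinate the property is the join preservation
of `H` there. -/
theorem isCompleteOperator_residual (i : Fin n) {σ' : Fin n → Pol}
    (hi : σ' i = s.op) (hj : ∀ j, j ≠ i → σ' j = σ j) :
    IsCompleteOperator (σ i).op σ' (residual s σ H i) := by
  constructor
  · intro u v huv
    rw [Pol.le_op, hH.le_residual_iff]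
    have h₁ : s.le (v i) (u i) := by have := huv i; rwa [hi, Pol.le_op] at this
    refine Pol.le_trans (Pol.le_trans (hH.mono _ (update v i (residual s σ H i v)) ?_)
      (hH.le_residual_iff.1 (Pol.le_refl _ _))) h₁
    intro j
    rcases eq_or_ne j i with rfl | hji
    · simpa using Pol.le_refl _ _
    · have := huv j
      rw [hj j hji] at this
      simpa [hji] using this
  · intro j u X y hX
    simp only [Pol.le_op, hH.le_residual_iff] at hX ⊢
    rcases eq_or_ne j i with rfl | hji
    · simp only [update_idem, update_self, hi] at hX ⊢
      rw [← Pol.le_op]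
      exact Pol.sSup_le fun x hx => Pol.le_op.2 (hX x hx)
    · rw [hj j hji]
      simp only [update_of_ne hji.symm, update_comm hji] at hX ⊢
      exact hH.sSup_le _ _ _ _ hX

/-- Taking the residual exchanges the `i`-th argument with the bound on the value. In the
interpolation data for `H`, the entry `a i` and the value bound `b` therefore simply change places.
-/
theorem interpolates_residual (hint : Interpolates e s σ H) (i : Fin n) {σ' : Fin n → Pol}
    (hi : σ' i = s.op) (hj : ∀ j, j ≠ i → σ' j = σ j) :
    Interpolates e (σ i).op σ' (residual s σ H i) := by
  intro k hk o ho hko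
  rw [Pol.op_op] at ho
  rw [Pol.le_op, hH.le_residual_iff] at hko
  obtain ⟨a, b, hka, hab, hbk⟩ := hint (update k i o) (fun j => by
    rcases eq_or_ne j i with rfl | hji
    · simpa using ho
    · simpa [hji, hj j hji] using hk j) (k i) (by rw [← hi]; exact hk i) hko
  refine ⟨update a i b, a i, fun j => ?_, ?_, ?_⟩
  · rcases eq_or_ne j i with rfl | hji
    · rw [hi, Pol.le_op]; simpa using hbk
    · simpa [hji, hj j hji] using hka j
  · rw [Pol.le_op, hH.le_residual_iff]
    have : update (fun j => e (update a i b j)) i (e (a i)) = fun j => e (a j) := by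
      funext j
      rcases eq_or_ne j i with rfl | hji
      · simp
      · simp [hji]
    rw [this]
    simpa using hab
  · rw [Pol.le_op]
    simpa using hka i

end IsCompleteOperator

end Residual

end Canonical

/-! ### Values of terms -/

namespace Pol

variable {A : Type*}

theorem inf_mono [Lattice A] {s : Pol} {x y x' y' : A} (h : s.le x x') (h' : s.le y y') :
    s.le (x ⊓ y) (x' ⊓ y') := by
  cases s
  · exact inf_le_inf h h'
  · exact inf_le_inf h h'

theorem join_mono [Lattice A] {s : Pol} {x y x' y' : A} (h : s.le x x') (h' : s.le y y') :
    s.le (x ⊔ y) (x' ⊔ y') := by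
  cases s
  · exact sup_le_sup h h'
  · exact sup_le_sup h h'

theorem sSup_pair [CompleteLattice A] (s : Pol) (x y : A) : s.sSup {x, y} = s.sup x y := by
  cases s
  · exact _root_.sSup_pair
  · exact _root_.sInf_pair

theorem sSup_empty [CompleteLattice A] (s : Pol) : s.sSup (∅ : Set A) = s.bot := by
  cases s
  · exact _root_.sSup_empty
  · exact _root_.sInf_empty

end Pol

theorem IsCompleteOperator.isOperator {C : Type w} [CompleteLattice C] {n : ℕ} {s : Pol}
    {σ : Fin n → Pol} {H : (Fin n → C) → C} (hH : IsCompleteOperator s σ H) :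
    IsOperator s σ H := by
  constructor
  · intro i u x y
    refine Pol.le_antisymm (s := s) ?_ (Pol.sup_le (hH.mono.update (Pol.le_sup_left _ _ _))
      (hH.mono.update (Pol.le_sup_right _ _ _)))
    rw [← Pol.sSup_pair]
    refine hH.sSup_le _ _ _ _ ?_
    rintro z (rfl | rfl)
    · exact Pol.le_sup_left _ _ _
    · exact Pol.le_sup_right _ _ _
  · intro i u
    refine Pol.le_antisymm (s := s) ?_ (Pol.bot_le _ _)
    rw [← Pol.sSup_empty]
    exact hH.sSup_le _ _ _ _ (by simp)

section Eval

variable {L : Signature.{u}} {V : Type} {A : Type v} [Lattice A] [BoundedOrder A]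

/-- The connectives in `F` and in `G` are interpreted by operators, resp. dual operators. -/
structure Ops.IsNormal (O : Ops L A) : Prop where
  opF : ∀ f, IsOperator .pos (fun i => Pol.pos.through (L.epsF f i)) (O.opF f)
  opG : ∀ g, IsOperator .neg (fun i => Pol.neg.through (L.epsG g i)) (O.opG g)

theorem LatticeExpansion.isNormal (𝔸 : LatticeExpansion L A) : 𝔸.toOps.IsNormal := by
  constructor
  · intro f
    constructor
    · intro i a x y
      cases h : L.epsF f i
      · exact 𝔸.f_sup f i h a x y
      · exact 𝔸.f_inf f i h a x y
    · intro i a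
      cases h : L.epsF f i
      · exact 𝔸.f_bot f i h a
      · exact 𝔸.f_top f i h a
  · intro g
    constructor
    · intro i a x y
      cases h : L.epsG g i
      · exact 𝔸.g_inf g i h a x y
      · exact 𝔸.g_sup g i h a x y
    · intro i a
      cases h : L.epsG g i
      · exact 𝔸.g_top g i h a
      · exact 𝔸.g_bot g i h a

variable {O : Ops L A}

theorem Term.eval_congr {v v' : V → A} : ∀ t : Term L V, (∀ x, t.Occurs x → v x = v' x) →
    t.eval O v = t.eval O v'
  | .atom x, h => h x rfl
  | .bot, _ => rfl
  | .top, _ => rfl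
  | .meet s t, h => congrArg₂ (· ⊓ ·) (s.eval_congr fun x hx => h x (.inl hx))
      (t.eval_congr fun x hx => h x (.inr hx))
  | .join s t, h => congrArg₂ (· ⊔ ·) (s.eval_congr fun x hx => h x (.inl hx))
      (t.eval_congr fun x hx => h x (.inr hx))
  | .opF f a, h => congrArg (O.opF f) (funext fun i =>
      (a i).eval_congr fun x hx => h x ⟨i, hx⟩)
  | .opG g a, h => congrArg (O.opG g) (funext fun i =>
      (a i).eval_congr fun x hx => h x ⟨i, hx⟩)

theorem Term.eval_update_of_not_occurs [DecidableEq V] {t : Term L V} {x : V}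
    (hx : ¬ t.Occurs x) (v : V → A) (c : A) : t.eval O (update v x c) = t.eval O v := by
  refine t.eval_congr fun y hy => update_of_ne ?_ _ _
  rintro rfl
  exact hx hy

theorem Term.eval_subst [DecidableEq V] (x : V) (r : Term L V) (v : V → A) : ∀ t : Term L V,
    (Term.subst x r t).eval O v = t.eval O (update v x (r.eval O v))
  | .atom y => by
    by_cases h : y = x
    · subst h; simp [Term.subst, Term.eval]
    · simp [Term.subst, Term.eval, h]
  | .bot => rfl
  | .top => rfl
  | .meet s t => congrArg₂ (· ⊓ ·) (Term.eval_subst x r v s) (Term.eval_subst x r v t)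
  | .join s t => congrArg₂ (· ⊔ ·) (Term.eval_subst x r v s) (Term.eval_subst x r v t)
  | .opF f a => congrArg (O.opF f) (funext fun i => Term.eval_subst x r v (a i))
  | .opG g a => congrArg (O.opG g) (funext fun i => Term.eval_subst x r v (a i))

/-- A term is monotone in an atom all of whose occurrences have the same sign. -/
theorem Term.eval_le_eval (hO : O.IsNormal) {x : V} {σ : Pol} {v v' : V → A}
    (hv : ∀ y, y ≠ x → v y = v' y) (hx : σ.le (v x) (v' x)) : ∀ (t : Term L V) (s : Pol),
    ¬ t.OccursWith x σ.op s → s.le (t.eval O v) (t.eval O v')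
  | .atom y, s, h => by
    by_cases hy : y = x
    · subst hy
      have hs : s = σ := by
        cases s <;> cases σ <;> first | rfl | exact absurd ⟨rfl, rfl⟩ h
      rwa [hs]
    · simp only [Term.eval, hv y hy]; exact Pol.le_refl _ _
  | .bot, s, _ => Pol.le_refl _ _
  | .top, s, _ => Pol.le_refl _ _
  | .meet t t', s, h => Pol.inf_mono (t.eval_le_eval hO hv hx s fun h' => h (.inl h'))
      (t'.eval_le_eval hO hv hx s fun h' => h (.inr h'))
  | .join t t', s, h => Pol.join_mono (t.eval_le_eval hO hv hx s fun h' => h (.inl h'))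
      (t'.eval_le_eval hO hv hx s fun h' => h (.inr h'))
  | .opF f a, s, h => by
    have ih : ∀ i, (s.through (L.epsF f i)).le ((a i).eval O v) ((a i).eval O v') :=
      fun i => (a i).eval_le_eval hO hv hx _ fun h' => h ⟨i, h'⟩
    cases s
    · exact (hO.opF f).mono _ _ ih
    -- With root sign `-` the signs of all arguments are flipped as well, so monotonicity is applied
    -- with the two assignments exchanged.
    · refine (hO.opF f).mono _ _ fun i => ?_
      have := ih i
      rwa [show Pol.neg = Pol.pos.op from rfl, Pol.through_op, Pol.le_op] at this
  | .opG g a, s, h => by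
    have ih : ∀ i, (s.through (L.epsG g i)).le ((a i).eval O v) ((a i).eval O v') :=
      fun i => (a i).eval_le_eval hO hv hx _ fun h' => h ⟨i, h'⟩
    cases s
    · refine (hO.opG g).mono _ _ fun i => ?_
      have := ih i
      rwa [show Pol.pos = Pol.neg.op from rfl, Pol.through_op, Pol.le_op] at this
    · exact (hO.opG g).mono _ _ ih

theorem Term.PositiveIn.eval_le {t : Term L V} {x : V} (ht : t.PositiveIn x) (hO : O.IsNormal)
    {v v' : V → A} (hv : ∀ y, y ≠ x → v y = v' y) (hx : v x ≤ v' x) :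
    t.eval O v ≤ t.eval O v' :=
  t.eval_le_eval hO (σ := .pos) hv hx .pos ht

theorem Term.NegativeIn.eval_le {t : Term L V} {x : V} (ht : t.NegativeIn x) (hO : O.IsNormal)
    {v v' : V → A} (hv : ∀ y, y ≠ x → v y = v' y) (hx : v x ≤ v' x) :
    t.eval O v' ≤ t.eval O v :=
  t.eval_le_eval hO (σ := .neg) (fun y hy => (hv y hy).symm) hx .pos ht

/-- The value of a context at a value of the placeholder. -/
def Ctx.eval (O : Ops L A) (h : V → A) : Ctx L V → A → A
  | .hole, c => c
  | .meetL C t, c => C.eval O h c ⊓ t.eval O h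
  | .meetR t C, c => t.eval O h ⊓ C.eval O h c
  | .joinL C t, c => C.eval O h c ⊔ t.eval O h
  | .joinR t C, c => t.eval O h ⊔ C.eval O h c
  | .opF f i a C, c => O.opF f (update (fun j => (a j).eval O h) i (C.eval O h c))
  | .opG g i a C, c => O.opG g (update (fun j => (a j).eval O h) i (C.eval O h c))

theorem Term.eval_update_args {n : ℕ} (a : Fin n → Term L V) (i : Fin n) (t : Term L V)
    (v : V → A) : (fun j => (update a i t j).eval O v) =
      update (fun j => (a j).eval O v) i (t.eval O v) := by
  funext j
  rcases eq_or_ne j i with rfl | hj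
  · simp
  · simp [hj]

theorem Ctx.eval_plug (v : V → A) (γ : Term L V) : ∀ C : Ctx L V,
    (C.plug γ).eval O v = C.eval O v (γ.eval O v)
  | .hole => rfl
  | .meetL C t => congrArg (· ⊓ t.eval O v) (C.eval_plug v γ)
  | .meetR t C => congrArg (t.eval O v ⊓ ·) (C.eval_plug v γ)
  | .joinL C t => congrArg (· ⊔ t.eval O v) (C.eval_plug v γ)
  | .joinR t C => congrArg (t.eval O v ⊔ ·) (C.eval_plug v γ)
  | .opF f i a C => by
    simp only [Ctx.plug, Term.eval, Ctx.eval, Term.eval_update_args, C.eval_plug v γ]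
  | .opG g i a C => by
    simp only [Ctx.plug, Term.eval, Ctx.eval, Term.eval_update_args, C.eval_plug v γ]

theorem Ctx.occurs_plug {x : V} {γ : Term L V} (hx : γ.Occurs x) : ∀ C : Ctx L V,
    (C.plug γ).Occurs x
  | .hole => hx
  | .meetL C _ => .inl (C.occurs_plug hx)
  | .meetR _ C => .inr (C.occurs_plug hx)
  | .joinL C _ => .inl (C.occurs_plug hx)
  | .joinR _ C => .inr (C.occurs_plug hx)
  | .opF _ i _ C => ⟨i, by simpa using C.occurs_plug hx⟩
  | .opG _ i _ C => ⟨i, by simpa using C.occurs_plug hx⟩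

theorem Ctx.eval_update_of_not_occurs [DecidableEq V] {x : V} {γ : Term L V} (v : V → A)
    (c d : A) : ∀ C : Ctx L V, ¬ (C.plug γ).Occurs x → C.eval O (update v x c) d = C.eval O v d
  | .hole, _ => rfl
  | .meetL C t, h => congrArg₂ _ (C.eval_update_of_not_occurs v c d fun h' => h (.inl h'))
      (Term.eval_update_of_not_occurs (fun h' => h (.inr h')) v c)
  | .meetR t C, h => congrArg₂ _ (Term.eval_update_of_not_occurs (fun h' => h (.inl h')) v c)
      (C.eval_update_of_not_occurs v c d fun h' => h (.inr h'))
  | .joinL C t, h => congrArg₂ _ (C.eval_update_of_not_occurs v c d fun h' => h (.inl h'))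
      (Term.eval_update_of_not_occurs (fun h' => h (.inr h')) v c)
  | .joinR t C, h => congrArg₂ _ (Term.eval_update_of_not_occurs (fun h' => h (.inl h')) v c)
      (C.eval_update_of_not_occurs v c d fun h' => h (.inr h'))
  | .opF f i a C, h => by
    refine congrArg (O.opF f) (funext fun j => ?_)
    rcases eq_or_ne j i with rfl | hj
    · simpa using C.eval_update_of_not_occurs v c d fun h' => h ⟨j, by simpa using h'⟩
    · simpa [hj] using Term.eval_update_of_not_occurs (t := a j)
        (fun h' => h ⟨j, by simpa [hj] using h'⟩) v c
  | .opG g i a C, h => by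
    refine congrArg (O.opG g) (funext fun j => ?_)
    rcases eq_or_ne j i with rfl | hj
    · simpa using C.eval_update_of_not_occurs v c d fun h' => h ⟨j, by simpa using h'⟩
    · simpa [hj] using Term.eval_update_of_not_occurs (t := a j)
        (fun h' => h ⟨j, by simpa [hj] using h'⟩) v c

theorem IsOperator.update_mono {s : Pol} {n : ℕ} {σ : Fin n → Pol} {h : (Fin n → A) → A}
    (hh : IsOperator s σ h) {u : Fin n → A} {i : Fin n} {x y : A} (hxy : (σ i).le x y) :
    s.le (h (update u i x)) (h (update u i y)) :=
  SignedMonotone.update hh.mono hxy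

/-- SLR contexts are monotone up to signs. -/
theorem Ctx.SLR.eval_mono (hO : O.IsNormal) (v : V → A) {x y : A} : ∀ {C : Ctx L V} {s : Pol},
    C.SLR s → (C.sign s).le x y → s.le (C.eval O v x) (C.eval O v y)
  | .hole, _, _, h => h
  | .opF f _ _ _, _, ⟨rfl, hC⟩, h => (hO.opF f).update_mono (SLR.eval_mono hO v hC h)
  | .opG g _ _ _, _, ⟨rfl, hC⟩, h => (hO.opG g).update_mono (SLR.eval_mono hO v hC h)

end Eval

/-! ### Preprocessing -/

section Preprocessing

variable {L : Signature.{u}} {A : Type v} [Lattice A] [BoundedOrder A] {O : Ops L A}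

/-- The inequality `i` holds under the assignment `v`. -/
def Ineq.Holds {V : Type} (O : Ops L A) (v : V → A) (i : Ineq L V) : Prop :=
  i.lhs.eval O v ≤ i.rhs.eval O v

/-- One direction is a substitution instance. For the other, uniformity makes `⊥` or `⊤` the worst
value of the letter: it maximises the left-hand side and minimises the right-hand side. -/
theorem ElimStep.valid_iff (hO : O.IsNormal) {i j : BIneq L} (h : ElimStep i j) :
    O.Valid i ↔ O.Valid j := by
  constructor
  · intro hi v
    cases h with
    | toBot α β p => simpa only [Term.eval_subst] using hi _
    | toTop α β p => simpa only [Term.eval_subst] using hi _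
  · intro hj v
    have hupd : ∀ (p : ℕ) (c : A) y, y ≠ p → update v p c y = v y :=
      fun p c y hy => update_of_ne hy _ _
    cases h with
    | toBot α β p _ hα hβ =>
      have h := hj v
      simp only [Term.eval_subst] at h
      exact (hα.eval_le hO (hupd p _) (by simp [Term.eval])).trans
        (h.trans (hβ.eval_le hO (hupd p _) (by simp [Term.eval])))
    | toTop α β p _ hα hβ =>
      have h := hj v
      simp only [Term.eval_subst] at h
      exact (hα.eval_le hO (fun y hy => (hupd p _ y hy).symm) (by simp [Term.eval])).trans
        (h.trans (hβ.eval_le hO (fun y hy => (hupd p _ y hy).symm) (by simp [Term.eval])))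

theorem DistRedex.eval_eq (hO : O.IsNormal) {s : Pol} {t t' : BTerm L} (h : DistRedex s t t')
    (v : ℕ → A) : t.eval O v = t'.eval O v := by
  cases h with
  | fJoin f i h a x y =>
    have := (hO.opF f).map_sup i (fun j => (a j).eval O v) (x.eval O v) (y.eval O v)
    rw [h] at this
    simp only [Term.eval, Term.eval_update_args]
    exact this
  | fMeet f i h a x y =>
    have := (hO.opF f).map_sup i (fun j => (a j).eval O v) (x.eval O v) (y.eval O v)
    rw [h] at this
    simp only [Term.eval, Term.eval_update_args]
    exact this
  | gMeet g i h a x y =>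
    have := (hO.opG g).map_sup i (fun j => (a j).eval O v) (x.eval O v) (y.eval O v)
    rw [h] at this
    simp only [Term.eval, Term.eval_update_args]
    exact this
  | gJoin g i h a x y =>
    have := (hO.opG g).map_sup i (fun j => (a j).eval O v) (x.eval O v) (y.eval O v)
    rw [h] at this
    simp only [Term.eval, Term.eval_update_args]
    exact this

theorem DistStep.valid_iff (hO : O.IsNormal) {i j : BIneq L} (h : DistStep i j) :
    O.Valid i ↔ O.Valid j := by
  refine forall_congr' fun v => ?_
  cases h with
  | left C s s' t h => simp only [Ctx.eval_plug, h.eval_eq hO v]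
  | right C s t t' h => simp only [Ctx.eval_plug, h.eval_eq hO v]

theorem Splits.holds_iff {V : Type} {i j k : Ineq L V} (h : Splits i j k) (v : V → A) :
    i.Holds O v ↔ j.Holds O v ∧ k.Holds O v := by
  cases h with
  | meet α β γ => exact le_inf_iff
  | join α β γ => exact sup_le_iff

theorem SplitStep.holds_iff {V : Type} {S T : Finset (Ineq L V)} (h : SplitStep S T)
    (v : V → A) : (∀ i ∈ S, i.Holds O v) ↔ ∀ i ∈ T, i.Holds O v := by
  cases h with
  | mk i j k hi h =>
    rw [← Finset.insert_erase hi]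
    simp only [Finset.forall_mem_insert, Finset.erase_insert_eq_erase, Finset.erase_idem,
      h.holds_iff, and_assoc]

/-- Only normality of the operations enters, so this applies both to `𝔸` and to its canonical
extension. -/
theorem Preprocess.valid_iff (hO : O.IsNormal) {i : BIneq L} {I : Finset (BIneq L)}
    (h : Preprocess i I) : O.Valid i ↔ ∀ k ∈ I, O.Valid k := by
  obtain ⟨i₁, i₂, ⟨h₁, -⟩, ⟨h₂, -⟩, ⟨h₃, -⟩⟩ := h
  have e₁ : O.Valid i ↔ O.Valid i₁ := by
    clear h₂ h₃
    induction h₁ with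
    | refl => exact Iff.rfl
    | tail _ h ih => exact ih.trans (h.valid_iff hO)
  have e₂ : O.Valid i₁ ↔ O.Valid i₂ := by
    clear h₃
    induction h₂ with
    | refl => exact Iff.rfl
    | tail _ h ih => exact ih.trans (h.valid_iff hO)
  have e₃ : ∀ v : ℕ → A, (∀ k ∈ ({i₂} : Finset (BIneq L)), k.Holds O v) ↔
      ∀ k ∈ I, k.Holds O v := by
    intro v
    induction h₃ with
    | refl => exact Iff.rfl
    | tail _ h ih => exact ih.trans (h.holds_iff v)
  rw [e₁, e₂]
  simp only [Finset.mem_singleton, forall_eq] at e₃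
  exact ⟨fun h k hk v => (e₃ v).1 (h v) k hk, fun h v => (e₃ v).2 fun k hk => h k hk v⟩

end Preprocessing

/-- An occurrence of `x` that has the sign `σ` for the sign `s` of the root has the opposite sign
for the opposite sign of the root. -/
theorem Term.occursWith_of_op {L : Signature.{u}} {V : Type} {x : V} :
    ∀ (t : Term L V) (σ s : Pol), t.OccursWith x σ.op s.op → t.OccursWith x σ s
  | .atom y, σ, s, h => by
    refine ⟨h.1, ?_⟩
    have := congrArg Pol.op h.2
    simpa using this
  | .meet t t', σ, s, h => h.imp (t.occursWith_of_op σ s) (t'.occursWith_of_op σ s)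
  | .join t t', σ, s, h => h.imp (t.occursWith_of_op σ s) (t'.occursWith_of_op σ s)
  | .opF f a, σ, s, ⟨i, h⟩ => ⟨i, (a i).occursWith_of_op σ _ (by rwa [← Pol.through_op])⟩
  | .opG g a, σ, s, ⟨i, h⟩ => ⟨i, (a i).occursWith_of_op σ _ (by rwa [← Pol.through_op])⟩

/-! ### The tense operations on the canonical extension -/

section Tense

variable {L : Signature.{u}} {A : Type v} {C : Type w} [Lattice A] [BoundedOrder A]
  [CompleteLattice C] (𝔸 : LatticeExpansion L A) (e : BoundedLatticeHom A C)

/-- The canonical extension with the residuals of its operations. -/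
def LatticeExpansion.tenseExtension : Ops L.tense C where
  opF
    | .base f => (𝔸.canonicalExtension e).opF f
    | .sharp f i _ => residual .pos (fun j => Pol.pos.through (L.epsF f j))
        ((𝔸.canonicalExtension e).opF f) i
    | .flat g i _ => residual .neg (fun j => Pol.neg.through (L.epsG g j))
        ((𝔸.canonicalExtension e).opG g) i
  opG
    | .base g => (𝔸.canonicalExtension e).opG g
    | .sharp f i _ => residual .pos (fun j => Pol.pos.through (L.epsF f j))
        ((𝔸.canonicalExtension e).opF f) i
    | .flat g i _ => residual .neg (fun j => Pol.neg.through (L.epsG g j))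
        ((𝔸.canonicalExtension e).opG g) i

variable {𝔸 e} (he : IsCanonicalExtension e)
include he

theorem canonicalExtension_opF_complete (f : L.F) :
    IsCompleteOperator .pos (fun i => Pol.pos.through (L.epsF f i))
      ((𝔸.canonicalExtension e).opF f) := by
  have := signedExt_isCompleteOperator (𝔸.isNormal.opF f) he
  rwa [← sigmaExt_eq] at this

theorem canonicalExtension_opG_complete (g : L.G) :
    IsCompleteOperator .neg (fun i => Pol.neg.through (L.epsG g i))
      ((𝔸.canonicalExtension e).opG g) := by
  have := signedExt_isCompleteOperator (𝔸.isNormal.opG g) he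
  rwa [← piExt_eq] at this

theorem canonicalExtension_isNormal : (𝔸.canonicalExtension e).IsNormal :=
  ⟨fun f => (canonicalExtension_opF_complete he f).isOperator,
    fun g => (canonicalExtension_opG_complete he g).isOperator⟩

/-- Both signs are available for a basic connective. This is why basic connectives may occur with
any sign in syntactically closed and open terms. -/
theorem canonicalExtension_opF_interpolates (f : L.F) (s : Pol) :
    Interpolates e s (fun i => s.through (L.epsF f i)) ((𝔸.canonicalExtension e).opF f) := by
  have h₁ := signedExt_interpolates (𝔸.isNormal.opF f) he
  have h₂ := signedExt_interpolates_op (𝔸.isNormal.opF f) he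
  rw [← sigmaExt_eq] at h₁ h₂
  simp only [← Pol.through_op] at h₂
  cases s
  · exact h₁
  · exact h₂

theorem canonicalExtension_opG_interpolates (g : L.G) (s : Pol) :
    Interpolates e s (fun i => s.through (L.epsG g i)) ((𝔸.canonicalExtension e).opG g) := by
  have h₁ := signedExt_interpolates (𝔸.isNormal.opG g) he
  have h₂ := signedExt_interpolates_op (𝔸.isNormal.opG g) he
  rw [← piExt_eq] at h₁ h₂
  simp only [← Pol.through_op] at h₂
  cases s
  · exact h₂
  · exact h₁

theorem eval_canonicalExtension (v : ℕ → A) : ∀ t : BTerm L,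
    t.eval (𝔸.canonicalExtension e) (fun p => e (v p)) = e (t.eval 𝔸.toOps v)
  | .atom _ => rfl
  | .bot => (map_bot e).symm
  | .top => (map_top e).symm
  | .meet s t => by
    simp only [Term.eval, eval_canonicalExtension v s, eval_canonicalExtension v t, map_inf]
  | .join s t => by
    simp only [Term.eval, eval_canonicalExtension v s, eval_canonicalExtension v t, map_sup]
  | .opF f a => by
    simp only [Term.eval, fun i => eval_canonicalExtension v (a i)]
    rw [← signedExt_map (𝔸.isNormal.opF f) he, ← sigmaExt_eq]
    rfl
  | .opG g a => by
    simp only [Term.eval, fun i => eval_canonicalExtension v (a i)]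
    rw [← signedExt_map (𝔸.isNormal.opG g) he, ← piExt_eq]
    rfl

theorem tenseExtension_opF_complete (c : TenseF L) :
    IsCompleteOperator .pos (fun i => Pol.pos.through (L.tense.epsF c i))
      ((𝔸.tenseExtension e).opF c) := by
  cases c with
  | base f => exact canonicalExtension_opF_complete he f
  | sharp f i h =>
    have := (canonicalExtension_opF_complete (𝔸 := 𝔸) he f).isCompleteOperator_residual i
      (σ' := fun j => Pol.pos.through (residualType (L.epsF f) i j))
      (by simp only [residualType, h]; rfl)
      (fun j hj => by simp only [residualType, h])
    simp only [h] at this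
    exact this
  | flat g i h =>
    have := (canonicalExtension_opG_complete (𝔸 := 𝔸) he g).isCompleteOperator_residual i
      (σ' := fun j => Pol.pos.through (residualType (L.epsG g) i j))
      (by simp only [residualType, h, if_true]; rfl)
      (fun j hj => by simp only [residualType, h, hj, if_false]; cases L.epsG g j <;> rfl)
    simp only [h] at this
    exact this

theorem tenseExtension_opG_complete (c : TenseG L) :
    IsCompleteOperator .neg (fun i => Pol.neg.through (L.tense.epsG c i))
      ((𝔸.tenseExtension e).opG c) := by
  cases c with
  | base g => exact canonicalExtension_opG_complete he g
  | sharp f i h =>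
    have := (canonicalExtension_opF_complete (𝔸 := 𝔸) he f).isCompleteOperator_residual i
      (σ' := fun j => Pol.neg.through (residualType (L.epsF f) i j))
      (by simp only [residualType, h, if_true]; rfl)
      (fun j hj => by simp only [residualType, h, hj, if_false]; cases L.epsF f j <;> rfl)
    simp only [h] at this
    exact this
  | flat g i h =>
    have := (canonicalExtension_opG_complete (𝔸 := 𝔸) he g).isCompleteOperator_residual i
      (σ' := fun j => Pol.neg.through (residualType (L.epsG g) i j))
      (by simp only [residualType, h]; rfl)
      (fun j hj => by simp only [residualType, h])
    simp only [h] at this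
    exact this

theorem tenseExtension_isNormal : (𝔸.tenseExtension e).IsNormal :=
  ⟨fun f => (tenseExtension_opF_complete he f).isOperator,
    fun g => (tenseExtension_opG_complete he g).isOperator⟩

/-- For a residual only the sign `+` is covered: it is the one obtained by exchanging argument and
bound in the basic operation. The side condition is the one imposed in `Term.SynClosed`. -/
theorem tenseExtension_opF_interpolates (c : TenseF L) {s : Pol}
    (hs : s = .pos ∨ ∃ f, c = .base f) :
    Interpolates e s (fun i => s.through (L.tense.epsF c i)) ((𝔸.tenseExtension e).opF c) := by
  cases c with
  | base f => exact canonicalExtension_opF_interpolates he f s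
  | sharp f i h =>
    obtain rfl : s = .pos := hs.resolve_right (by simp)
    have := (canonicalExtension_opF_complete (𝔸 := 𝔸) he f).interpolates_residual
      (canonicalExtension_opF_interpolates he f _) i
      (σ' := fun j => Pol.pos.through (residualType (L.epsF f) i j))
      (by simp only [residualType, h]; rfl)
      (fun j hj => by simp only [residualType, h])
    simp only [h] at this
    exact this
  | flat g i h =>
    obtain rfl : s = .pos := hs.resolve_right (by simp)
    have := (canonicalExtension_opG_complete (𝔸 := 𝔸) he g).interpolates_residual
      (canonicalExtension_opG_interpolates he g _) i
      (σ' := fun j => Pol.pos.through (residualType (L.epsG g) i j))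
      (by simp only [residualType, h, if_true]; rfl)
      (fun j hj => by simp only [residualType, h, hj, if_false]; cases L.epsG g j <;> rfl)
    simp only [h] at this
    exact this

theorem tenseExtension_opG_interpolates (c : TenseG L) {s : Pol}
    (hs : s = .neg ∨ ∃ g, c = .base g) :
    Interpolates e s (fun i => s.through (L.tense.epsG c i)) ((𝔸.tenseExtension e).opG c) := by
  cases c with
  | base g => exact canonicalExtension_opG_interpolates he g s
  | sharp f i h =>
    obtain rfl : s = .neg := hs.resolve_right (by simp)
    have := (canonicalExtension_opF_complete (𝔸 := 𝔸) he f).interpolates_residual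
      (canonicalExtension_opF_interpolates he f _) i
      (σ' := fun j => Pol.neg.through (residualType (L.epsF f) i j))
      (by simp only [residualType, h, if_true]; rfl)
      (fun j hj => by simp only [residualType, h, hj, if_false]; cases L.epsF f j <;> rfl)
    simp only [h] at this
    exact this
  | flat g i h =>
    obtain rfl : s = .neg := hs.resolve_right (by simp)
    have := (canonicalExtension_opG_complete (𝔸 := 𝔸) he g).interpolates_residual
      (canonicalExtension_opG_interpolates he g _) i
      (σ' := fun j => Pol.neg.through (residualType (L.epsG g) i j))
      (by simp only [residualType, h]; rfl)
      (fun j hj => by simp only [residualType, h])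
    simp only [h] at this
    exact this

omit he in
theorem eval_embed (v : Atom → C) : ∀ t : BTerm L,
    t.embed.eval (𝔸.tenseExtension e) v =
      t.eval (𝔸.canonicalExtension e) (fun p => v (.prop p))
  | .atom _ => rfl
  | .bot => rfl
  | .top => rfl
  | .meet s t => congrArg₂ (· ⊓ ·) (eval_embed v s) (eval_embed v t)
  | .join s t => congrArg₂ (· ⊔ ·) (eval_embed v s) (eval_embed v t)
  | .opF f a => congrArg ((𝔸.canonicalExtension e).opF f) (funext fun i => eval_embed v (a i))
  | .opG g a => congrArg ((𝔸.canonicalExtension e).opG g) (funext fun i => eval_embed v (a i))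

end Tense

/-! ### Syntactically closed and open terms -/

section Syntactic

variable {L : Signature.{u}}

/-- Syntactically closed terms for the sign `+`, and syntactically open terms for the sign `-`:
in the generation tree whose root has the sign `s`, nominals and the connectives in `F*` outside
`F` occur with the sign `+`, co-nominals and the connectives in `G*` outside `G` with the
sign `-`. -/
def Term.SynClosed : Pol → ETerm L → Prop
  | _, .atom (.prop _) => True
  | s, .atom (.nom _) => s = .pos
  | s, .atom (.conom _) => s = .neg
  | _, .bot => True
  | _, .top => True
  | s, .meet t t' => t.SynClosed s ∧ t'.SynClosed s
  | s, .join t t' => t.SynClosed s ∧ t'.SynClosed s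
  | s, .opF c a => (s = .pos ∨ ∃ f, c = .base f) ∧
      ∀ i, (a i).SynClosed (s.through (L.tense.epsF c i))
  | s, .opG c a => (s = .neg ∨ ∃ g, c = .base g) ∧
      ∀ i, (a i).SynClosed (s.through (L.tense.epsG c i))

theorem Term.synClosed_embed : ∀ (t : BTerm L) (s : Pol), t.embed.SynClosed s
  | .atom _, _ => trivial
  | .bot, _ => trivial
  | .top, _ => trivial
  | .meet t t', s => ⟨t.synClosed_embed s, t'.synClosed_embed s⟩
  | .join t t', s => ⟨t.synClosed_embed s, t'.synClosed_embed s⟩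
  | .opF f a, _ => ⟨.inr ⟨f, rfl⟩, fun i => (a i).synClosed_embed _⟩
  | .opG g a, _ => ⟨.inr ⟨g, rfl⟩, fun i => (a i).synClosed_embed _⟩

theorem Term.SynClosed.bigJoin {s : Pol} : ∀ {l : List (ETerm L)}, (∀ t ∈ l, t.SynClosed s) →
    (Term.bigJoin l).SynClosed s
  | [], _ => trivial
  | [a], h => h a (by simp)
  | a :: b :: l, h => ⟨h a (by simp), SynClosed.bigJoin fun t ht => h t (by simp_all)⟩

theorem Term.SynClosed.bigMeet {s : Pol} : ∀ {l : List (ETerm L)}, (∀ t ∈ l, t.SynClosed s) →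
    (Term.bigMeet l).SynClosed s
  | [], _ => trivial
  | [a], h => h a (by simp)
  | a :: b :: l, h => ⟨h a (by simp), SynClosed.bigMeet fun t ht => h t (by simp_all)⟩

/-- All leaves `p` have sign `σ`, which is exactly the sign at which `r` is known to be
syntactically closed. -/
theorem Term.SynClosed.subst {p : ℕ} {σ : Pol} {r : ETerm L} (hr : r.SynClosed σ) :
    ∀ (t : ETerm L) (s : Pol), t.SynClosed s → ¬ t.OccursWith (.prop p) σ.op s →
      (Term.subst (.prop p) r t).SynClosed s
  | .atom x, s, h, h' => by
    by_cases hx : x = .prop p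
    · have hs : s = σ := by
        cases s <;> cases σ <;> first | rfl | exact absurd ⟨hx, rfl⟩ h'
      simpa [Term.subst, hx, hs] using hr
    · simpa [Term.subst, hx] using h
  | .bot, _, _, _ => trivial
  | .top, _, _, _ => trivial
  | .meet t t', s, h, h' => ⟨hr.subst t s h.1 fun h => h' (.inl h),
      hr.subst t' s h.2 fun h => h' (.inr h)⟩
  | .join t t', s, h, h' => ⟨hr.subst t s h.1 fun h => h' (.inl h),
      hr.subst t' s h.2 fun h => h' (.inr h)⟩
  | .opF c a, _, h, h' => ⟨h.1, fun i => hr.subst (a i) _ (h.2 i) fun h => h' ⟨i, h⟩⟩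
  | .opG c a, _, h, h' => ⟨h.1, fun i => hr.subst (a i) _ (h.2 i) fun h => h' ⟨i, h⟩⟩

end Syntactic

/-! ### Approximation of closed values by values on `A` -/

section Approximation

variable {A : Type v} {C : Type w} [Lattice A] [BoundedOrder A] [CompleteLattice C]
  {e : BoundedLatticeHom A C} {s σ : Pol}

/-- The filter of the elements of `A` above `k`, in the direction of `k`, up to the sign `σ`. -/
def approxFilter (e : BoundedLatticeHom A C) (σ : Pol) (k : C) : Filter A where
  sets := {U | ∃ a, σ.le k (e a) ∧ ∀ a', σ.le a' a → σ.le k (e a') → a' ∈ U}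
  univ_sets := ⟨σ.op.bot, by rw [map_signed_bot]; exact Pol.le_top _ _, fun _ _ _ => trivial⟩
  sets_of_superset := by
    rintro U V ⟨a, ha, h⟩ hUV
    exact ⟨a, ha, fun a' h₁ h₂ => hUV (h a' h₁ h₂)⟩
  inter_sets := by
    rintro U V ⟨a, ha, h⟩ ⟨b, hb, h'⟩
    refine ⟨σ.op.sup a b, ?_, fun a' h₁ h₂ => ⟨?_, ?_⟩⟩
    · rw [map_signed_sup]; exact Pol.le_op_sup ha hb
    · exact h a' (Pol.le_trans h₁ (Pol.op_sup_le_left _ _ _)) h₂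
    · exact h' a' (Pol.le_trans h₁ (Pol.op_sup_le_right _ _ _)) h₂

theorem eventually_approxFilter {k : C} {P : A → Prop} :
    (∀ᶠ a in approxFilter e σ k, P a) ↔
      ∃ a, σ.le k (e a) ∧ ∀ a', σ.le a' a → σ.le k (e a') → P a' := Iff.rfl

theorem eventually_approxFilter_le (k : C) : ∀ᶠ a in approxFilter e σ k, σ.le k (e a) :=
  ⟨σ.op.bot, by rw [map_signed_bot]; exact Pol.le_top _ _, fun _ _ h => h⟩

instance (k : C) : (approxFilter e σ k).NeBot := by
  refine ⟨fun h => ?_⟩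
  have : ∀ᶠ a in approxFilter e σ k, False := by rw [h]; trivial
  obtain ⟨a, ha, h'⟩ := eventually_approxFilter.1 this
  -- The threshold `a` itself belongs to every set that it generates, so no such set is empty.
  exact h' a (Pol.le_refl _ _) ha

/-- Each open element above `z` has an element of `A` below it that is eventually above `w`. -/
def Approximates (e : BoundedLatticeHom A C) (F : Filter A) (s : Pol) (z : C) (w : A → C) :
    Prop :=
  ∀ o ∈ signedClosed e s.op, s.le z o → ∃ b, s.le (e b) o ∧ ∀ᶠ a in F, s.le (w a) (e b)

namespace Approximates

variable {F : Filter A} {z z' : C} {w w' : A → C}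

/-- For an open `o` above `z`, any sufficiently late `w a` lies between `z` and an element of `A`
below `o`. That element is an interpolant. -/
theorem mem_signedClosed (he : IsCanonicalExtension e) [F.NeBot] (h : Approximates e F s z w)
    (hz : ∀ᶠ a in F, s.le z (w a)) : z ∈ signedClosed e s := by
  refine he.mem_signedClosed fun o ho hzo => ?_
  obtain ⟨b, hbo, hb⟩ := h o ho hzo
  obtain ⟨a, ha, ha'⟩ := (hb.and hz).exists
  exact ⟨b, Pol.le_trans ha' ha, hbo⟩

theorem const (he : IsCanonicalExtension e) (hz : z ∈ signedClosed e s) :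
    Approximates e F s z fun _ => z := by
  intro o ho hzo
  obtain ⟨b, hzb, hbo⟩ := he.exists_between hz ho hzo
  exact ⟨b, hbo, Filter.Eventually.of_forall fun _ => hzb⟩

theorem self (he : IsCanonicalExtension e) (hz : z ∈ signedClosed e s) :
    Approximates e (approxFilter e s z) s z fun a => e a := by
  intro o ho hzo
  obtain ⟨b, hzb, hbo⟩ := he.exists_between hz ho hzo
  exact ⟨b, hbo, b, hzb, fun a ha _ => map_signed_le e ha⟩

theorem sup (h : Approximates e F s z w) (h' : Approximates e F s z' w') :
    Approximates e F s (s.sup z z') fun a => s.sup (w a) (w' a) := by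
  intro o ho hzo
  obtain ⟨b, hbo, hb⟩ := h o ho (Pol.le_trans (Pol.le_sup_left _ _ _) hzo)
  obtain ⟨b', hbo', hb'⟩ := h' o ho (Pol.le_trans (Pol.le_sup_right _ _ _) hzo)
  refine ⟨s.sup b b', ?_, ?_⟩
  · rw [map_signed_sup]; exact Pol.sup_le hbo hbo'
  · filter_upwards [hb, hb'] with a ha ha'
    rw [map_signed_sup]; exact Pol.sup_mono ha ha'

/-- At sign `+` this is the case of binary meets. Unlike for joins, an open bound on `z ⊓ z'` does
not bound `z` and `z'` separately, so compactness is needed to split it. -/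
theorem op_sup (he : IsCanonicalExtension e) (hz : z ∈ signedClosed e s)
    (hz' : z' ∈ signedClosed e s) (h : Approximates e F s z w) (h' : Approximates e F s z' w') :
    Approximates e F s (s.op.sup z z') fun a => s.op.sup (w a) (w' a) := by
  intro o ho hzo
  -- `D` is the filter (up to sign) generated by the meets of an approximation of `z` with one of
  -- `z'`; its meet is below that of `z` and `z'`.
  set D : Set A := {d | ∃ a b, s.le z (e a) ∧ s.le z' (e b) ∧ s.le (s.op.sup a b) d}
  have htop : ∀ x : C, s.le x (e s.op.bot) := fun x => by
    rw [map_signed_bot]; exact Pol.le_top _ _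
  have hD : s.le (s.op.sSup (e '' D)) (s.op.sup z z') := by
    refine Pol.le_op_sup (Pol.le_trans ?_ (signedClosed_meet_le hz))
      (Pol.le_trans ?_ (signedClosed_meet_le hz'))
    · exact Pol.le_op.1 (Pol.sSup_mono (Set.image_mono fun a ha =>
        ⟨a, s.op.bot, ha, htop _, Pol.op_sup_le_left _ _ _⟩))
    · exact Pol.le_op.1 (Pol.sSup_mono (Set.image_mono fun a ha =>
        ⟨s.op.bot, a, htop _, ha, Pol.op_sup_le_right _ _ _⟩))
  obtain ⟨d, ⟨a₀, b₀, ha₀, hb₀, hd⟩, hdo⟩ := he.exists_le_of_directed ho (D := D)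
    ⟨s.op.bot, s.op.bot, s.op.bot, htop _, htop _, Pol.le_top _ _⟩ (by
      rintro d ⟨a, b, ha, hb, hd⟩ d' ⟨a', b', ha', hb', hd'⟩
      refine ⟨s.op.sup d d', ⟨s.op.sup a a', s.op.sup b b', ?_, ?_, ?_⟩,
        Pol.le_sup_left _ _ _, Pol.le_sup_right _ _ _⟩
      · rw [map_signed_sup]; exact Pol.le_op_sup ha ha'
      · rw [map_signed_sup]; exact Pol.le_op_sup hb hb'
      · refine Pol.le_op_sup (Pol.le_trans ?_ hd) (Pol.le_trans ?_ hd')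
        · exact Pol.le_op.1 (Pol.sup_mono (Pol.le_sup_left _ _ _) (Pol.le_sup_left _ _ _))
        · exact Pol.le_op.1 (Pol.sup_mono (Pol.le_sup_right _ _ _) (Pol.le_sup_right _ _ _)))
    (Pol.le_op.2 (Pol.le_trans hD hzo))
  rw [Pol.le_op] at hdo
  -- The components `a₀` and `b₀` lie in `A`, hence are open, and can serve as bounds for the two
  -- given approximations.
  obtain ⟨a₁, ha₁, hw⟩ := h _ (map_mem_signedClosed e _ a₀) ha₀
  obtain ⟨b₁, hb₁, hw'⟩ := h' _ (map_mem_signedClosed e _ b₀) hb₀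
  refine ⟨d, hdo, ?_⟩
  filter_upwards [hw, hw'] with a ha ha'
  refine Pol.le_trans ?_ (map_signed_le e hd)
  rw [map_signed_sup]
  exact Pol.le_op.1 (Pol.sup_mono (Pol.le_op.2 (Pol.le_trans ha ha₁))
    (Pol.le_op.2 (Pol.le_trans ha' hb₁)))

theorem inf (he : IsCanonicalExtension e) (hz : z ∈ signedClosed e s)
    (hz' : z' ∈ signedClosed e s) (h : Approximates e F s z w) (h' : Approximates e F s z' w') :
    Approximates e F s (z ⊓ z') fun a => w a ⊓ w' a := by
  cases s
  · exact op_sup he hz hz' h h'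
  · exact sup h h'

theorem join (he : IsCanonicalExtension e) (hz : z ∈ signedClosed e s)
    (hz' : z' ∈ signedClosed e s) (h : Approximates e F s z w) (h' : Approximates e F s z' w') :
    Approximates e F s (z ⊔ z') fun a => w a ⊔ w' a := by
  cases s
  · exact sup h h'
  · exact op_sup he hz hz' h h'

/-- Interpolation yields a tuple of `A` above `k` with value below the bound. Each of the finitely
many arguments is eventually below its entry of this tuple, and monotonicity concludes. -/
theorem operation {n : ℕ} {τ : Fin n → Pol} {H : (Fin n → C) → C}
    (hint : Interpolates e s τ H) (hmono : SignedMonotone s τ H) {k : Fin n → C}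
    {f : Fin n → A → C} (hk : ∀ i, k i ∈ signedClosed e (τ i))
    (h : ∀ i, Approximates e F (τ i) (k i) (f i)) :
    Approximates e F s (H k) fun a => H fun i => f i a := by
  intro o ho hko
  obtain ⟨a, b, hka, hab, hbo⟩ := hint k hk o ho hko
  refine ⟨b, hbo, ?_⟩
  have : ∀ i, ∀ᶠ x in F, (τ i).le (f i x) (e (a i)) := fun i => by
    obtain ⟨c, hca, hc⟩ := h i _ (map_mem_signedClosed e _ (a i)) (hka i)
    exact hc.mono fun x hx => Pol.le_trans hx hca
  filter_upwards [Filter.eventually_all.2 this] with x hx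
  exact Pol.le_trans (hmono _ _ hx) hab

end Approximates

theorem SignedMonotone.op {X : Type*} [LE X] {n : ℕ} {s : Pol} {τ : Fin n → Pol}
    {H : (Fin n → X) → X} (h : SignedMonotone s τ H) :
    SignedMonotone s.op (fun i => (τ i).op) H := fun a b hab =>
  Pol.le_op.2 (h b a fun i => Pol.le_op.1 (hab i))

theorem SignedMonotone.through {X : Type*} [LE X] {n : ℕ} {s : Pol} {ε : Fin n → Pol}
    {H : (Fin n → X) → X} (h : SignedMonotone s (fun i => s.through (ε i)) H) (t : Pol) :
    SignedMonotone t (fun i => t.through (ε i)) H := by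
  have h' := h.op
  simp only [← Pol.through_op] at h'
  cases s <;> cases t <;> assumption

variable {L : Signature.{u}} {𝔸 : LatticeExpansion L A}

/-- The topological core of Ackermann's lemma: a syntactically closed term that is monotone in
the letter `p` commutes with the approximation of a closed value of `p` by elements of `A`. -/
theorem Term.SynClosed.approximates (he : IsCanonicalExtension e) {p : ℕ} {v : Atom → C}
    (hprop : ∀ q, q ≠ p → v (.prop q) ∈ Set.range e)
    (hp : v (.prop p) ∈ signedClosed e σ)
    (hnom : ∀ k, v (.nom k) ∈ signedClosed e .pos)
    (hconom : ∀ k, v (.conom k) ∈ signedClosed e .neg) :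
    ∀ (t : ETerm L) (s : Pol), t.SynClosed s → ¬ t.OccursWith (.prop p) σ.op s →
      t.eval (𝔸.tenseExtension e) v ∈ signedClosed e s ∧
      Approximates e (approxFilter e σ (v (.prop p))) s (t.eval (𝔸.tenseExtension e) v)
        fun a => t.eval (𝔸.tenseExtension e) (update v (.prop p) (e a)) := by
  have hle : ∀ (t : ETerm L) (s : Pol), ¬ t.OccursWith (.prop p) σ.op s →
      ∀ᶠ a in approxFilter e σ (v (.prop p)), s.le (t.eval (𝔸.tenseExtension e) v)
        (t.eval (𝔸.tenseExtension e) (update v (.prop p) (e a))) := by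
    intro t s ht
    filter_upwards [eventually_approxFilter_le _] with a ha
    exact t.eval_le_eval (tenseExtension_isNormal he) (fun y hy => (update_of_ne hy _ _).symm)
      (by simpa using ha) s ht
  -- Closedness of the value follows from approximation together with the monotonicity in `hle`, so
  -- only approximation is carried through the induction.
  suffices H : ∀ (t : ETerm L) (s : Pol), t.SynClosed s → ¬ t.OccursWith (.prop p) σ.op s →
      Approximates e (approxFilter e σ (v (.prop p))) s (t.eval (𝔸.tenseExtension e) v)
        fun a => t.eval (𝔸.tenseExtension e) (update v (.prop p) (e a)) from
    fun t s ht ht' => ⟨(H t s ht ht').mem_signedClosed he (hle t s ht'), H t s ht ht'⟩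
  have hconst : ∀ (x : Atom) (s : Pol), x ≠ .prop p → v x ∈ signedClosed e s →
      Approximates e (approxFilter e σ (v (.prop p))) s (v x)
        fun a => update v (.prop p) (e a) x := by
    intro x s hx hv
    simp only [update_of_ne hx]
    exact Approximates.const he hv
  intro t
  induction t with
  | atom x =>
    intro s ht ht'
    cases x with
    | prop q =>
      by_cases hq : q = p
      · subst hq
        have hs : s = σ := by
          cases s <;> cases σ <;> first | rfl | exact absurd ⟨rfl, rfl⟩ ht'
        subst hs
        simpa [Term.eval] using Approximates.self he hp
      · obtain ⟨a, ha⟩ := hprop q hq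
        exact hconst (.prop q) s (by simpa using hq) (ha ▸ map_mem_signedClosed e s a)
    | nom k => obtain rfl : s = .pos := ht; exact hconst (.nom k) _ (by simp) (hnom k)
    | conom k => obtain rfl : s = .neg := ht; exact hconst (.conom k) _ (by simp) (hconom k)
  | bot =>
    intro s _ _
    exact Approximates.const he (by simpa [Term.eval] using map_mem_signedClosed e s ⊥)
  | top =>
    intro s _ _
    exact Approximates.const he (by simpa [Term.eval] using map_mem_signedClosed e s ⊤)
  | meet t t' ih ih' =>
    intro s ht ht'
    have h₁ : ¬ t.OccursWith (.prop p) σ.op s := fun h => ht' (.inl h)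
    have h₂ : ¬ t'.OccursWith (.prop p) σ.op s := fun h => ht' (.inr h)
    exact Approximates.inf he ((ih s ht.1 h₁).mem_signedClosed he (hle _ _ h₁))
      ((ih' s ht.2 h₂).mem_signedClosed he (hle _ _ h₂)) (ih s ht.1 h₁) (ih' s ht.2 h₂)
  | join t t' ih ih' =>
    intro s ht ht'
    have h₁ : ¬ t.OccursWith (.prop p) σ.op s := fun h => ht' (.inl h)
    have h₂ : ¬ t'.OccursWith (.prop p) σ.op s := fun h => ht' (.inr h)
    exact Approximates.join he ((ih s ht.1 h₁).mem_signedClosed he (hle _ _ h₁))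
      ((ih' s ht.2 h₂).mem_signedClosed he (hle _ _ h₂)) (ih s ht.1 h₁) (ih' s ht.2 h₂)
  | opF c a ih =>
    intro s ht ht'
    have h₁ : ∀ i, ¬ (a i).OccursWith (.prop p) σ.op (s.through (L.tense.epsF c i)) :=
      fun i h => ht' ⟨i, h⟩
    exact Approximates.operation (tenseExtension_opF_interpolates he c ht.1)
      ((tenseExtension_opF_complete he c).mono.through s)
      (fun i => (ih i _ (ht.2 i) (h₁ i)).mem_signedClosed he (hle _ _ (h₁ i)))
      fun i => ih i _ (ht.2 i) (h₁ i)
  | opG c a ih =>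
    intro s ht ht'
    have h₁ : ∀ i, ¬ (a i).OccursWith (.prop p) σ.op (s.through (L.tense.epsG c i)) :=
      fun i h => ht' ⟨i, h⟩
    exact Approximates.operation (tenseExtension_opG_interpolates he c ht.1)
      ((tenseExtension_opG_complete he c).mono.through s)
      (fun i => (ih i _ (ht.2 i) (h₁ i)).mem_signedClosed he (hle _ _ (h₁ i)))
      fun i => ih i _ (ht.2 i) (h₁ i)

end Approximation

/-! ### Soundness of the reduction steps -/

section Occurrences

variable {L : Signature.{u}} {V : Type}

theorem Term.OccursWith.occurs {x : V} {σ : Pol} : ∀ {t : Term L V} {s : Pol},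
    t.OccursWith x σ s → t.Occurs x
  | .atom _, _, h => h.1
  | .meet _ _, _, h => h.imp occurs occurs
  | .join _ _, _, h => h.imp occurs occurs
  | .opF _ _, _, ⟨i, h⟩ => ⟨i, occurs h⟩
  | .opG _ _, _, ⟨i, h⟩ => ⟨i, occurs h⟩

theorem Term.occurs_bigJoin {x : V} : ∀ {l : List (Term L V)}, (Term.bigJoin l).Occurs x →
    ∃ t ∈ l, t.Occurs x
  | [], h => h.elim
  | [a], h => ⟨a, by simp, h⟩
  | a :: b :: l, h => by
    rcases h with h | h
    · exact ⟨a, by simp, h⟩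
    · obtain ⟨t, ht, h⟩ := occurs_bigJoin h
      exact ⟨t, List.mem_cons_of_mem a ht, h⟩

theorem Term.occurs_bigMeet {x : V} : ∀ {l : List (Term L V)}, (Term.bigMeet l).Occurs x →
    ∃ t ∈ l, t.Occurs x
  | [], h => h.elim
  | [a], h => ⟨a, by simp, h⟩
  | a :: b :: l, h => by
    rcases h with h | h
    · exact ⟨a, by simp, h⟩
    · obtain ⟨t, ht, h⟩ := occurs_bigMeet h
      exact ⟨t, List.mem_cons_of_mem a ht, h⟩

variable {A : Type v} [Lattice A] [BoundedOrder A] {O : Ops L A}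

theorem Term.eval_bigJoin_le {v : V → A} {y : A} : ∀ {l : List (Term L V)},
    (Term.bigJoin l).eval O v ≤ y ↔ ∀ t ∈ l, t.eval O v ≤ y
  | [] => by simp [Term.bigJoin, Term.eval]
  | [a] => by simp [Term.bigJoin]
  | a :: b :: l => by
    have ih := Term.eval_bigJoin_le (v := v) (y := y) (l := b :: l)
    simp only [Term.bigJoin, Term.eval, sup_le_iff, ih]
    simp

theorem Term.le_eval_bigMeet {v : V → A} {y : A} : ∀ {l : List (Term L V)},
    y ≤ (Term.bigMeet l).eval O v ↔ ∀ t ∈ l, y ≤ t.eval O v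
  | [] => by simp [Term.bigMeet, Term.eval]
  | [a] => by simp [Term.bigMeet]
  | a :: b :: l => by
    have ih := Term.le_eval_bigMeet (v := v) (y := y) (l := b :: l)
    simp only [Term.bigMeet, Term.eval, le_inf_iff, ih]
    simp

theorem Ineq.holds_congr {i : Ineq L V} {v v' : V → A} (h : ∀ x, i.Occurs x → v x = v' x) :
    i.Holds O v ↔ i.Holds O v' := by
  rw [Ineq.Holds, Ineq.Holds, i.lhs.eval_congr fun x hx => h x (.inl hx),
    i.rhs.eval_congr fun x hx => h x (.inr hx)]

theorem Ineq.holds_update [DecidableEq V] {i : Ineq L V} {x : V} (hx : ¬ i.Occurs x)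
    (v : V → A) (c : A) : i.Holds O (update v x c) ↔ i.Holds O v := by
  refine Ineq.holds_congr fun y hy => update_of_ne ?_ _ _
  rintro rfl
  exact hx hy

theorem Ineq.holds_subst [DecidableEq V] (i : Ineq L V) (x : V) (r : Term L V) (v : V → A) :
    (i.subst x r).Holds O v ↔ i.Holds O (update v x (r.eval O v)) := by
  simp only [Ineq.Holds, Ineq.subst, Term.eval_subst]

end Occurrences

/-! ### Admissible assignments, the syntactic invariant and soundness of each rule -/

section Steps

variable {L : Signature.{u}} {A : Type v} {C : Type w} [Lattice A] [BoundedOrder A]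
  [CompleteLattice C] {e : BoundedLatticeHom A C}

/-- Assignments of elements of `P` to the proposition letters, of closed elements to the nominals,
and of open elements to the co-nominals. -/
structure Admissible (e : BoundedLatticeHom A C) (P : Set C) (v : Atom → C) : Prop where
  prop : ∀ k, v (.prop k) ∈ P
  nom : ∀ k, v (.nom k) ∈ signedClosed e .pos
  conom : ∀ k, v (.conom k) ∈ signedClosed e .neg

theorem Admissible.update_prop {P : Set C} {v : Atom → C} (hv : Admissible e P v) (p : ℕ) {c : C}
    (hc : c ∈ P) : Admissible e P (update v (.prop p) c) := by
  refine ⟨fun k => ?_, fun k => ?_, fun k => ?_⟩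
  · by_cases h : k = p
    · subst h; simpa using hc
    · simpa [update_of_ne, h] using hv.prop k
  · simpa using hv.nom k
  · simpa using hv.conom k

theorem Admissible.update_nom {P : Set C} {v : Atom → C} (hv : Admissible e P v) (j : ℕ) {c : C}
    (hc : c ∈ signedClosed e .pos) : Admissible e P (update v (.nom j) c) := by
  refine ⟨fun k => ?_, fun k => ?_, fun k => ?_⟩
  · simpa using hv.prop k
  · by_cases h : k = j
    · subst h; simpa using hc
    · simpa [update_of_ne, h] using hv.nom k
  · simpa using hv.conom k

theorem Admissible.update_conom {P : Set C} {v : Atom → C} (hv : Admissible e P v) (m : ℕ) {c : C}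
    (hc : c ∈ signedClosed e .neg) : Admissible e P (update v (.conom m) c) := by
  refine ⟨fun k => ?_, fun k => ?_, fun k => ?_⟩
  · simpa using hv.prop k
  · simpa using hv.nom k
  · by_cases h : k = m
    · subst h; simpa using hc
    · simpa [update_of_ne, h] using hv.conom k

/-- Validity of a system as a quasi-inequality, for the assignments of elements of `P` to the
proposition letters. -/
def System.Valid (O : Ops L.tense C) (e : BoundedLatticeHom A C) (P : Set C) (X : System L) :
    Prop :=
  ∀ v, Admissible e P v → (∀ i ∈ X.S, i.Holds O v) → X.main.Holds O v

/-- The left-hand sides in `S` are syntactically closed, the right-hand sides syntactically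
open. -/
def System.SynClosed (X : System L) : Prop :=
  ∀ i ∈ X.S, i.lhs.SynClosed .pos ∧ i.rhs.SynClosed .neg

/-- The step from `X` to `Y` preserves syntactic closedness and validity for assignments in `A`,
and it reflects validity for assignments in the canonical extension. -/
structure SoundStep (𝔸 : LatticeExpansion L A) (e : BoundedLatticeHom A C) (X Y : System L) :
    Prop where
  synClosed : X.SynClosed → Y.SynClosed
  valid : X.SynClosed → X.Valid (𝔸.tenseExtension e) e (Set.range e) →
    Y.Valid (𝔸.tenseExtension e) e (Set.range e)
  valid_of_valid : Y.Valid (𝔸.tenseExtension e) e Set.univ →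
    X.Valid (𝔸.tenseExtension e) e Set.univ

theorem SoundStep.of_holds_iff {𝔸 : LatticeExpansion L A} {S T : Finset (EIneq L)}
    {main : EIneq L} (hsyn : System.SynClosed ⟨S, main⟩ → System.SynClosed ⟨T, main⟩)
    (h : ∀ v, (∀ i ∈ S, i.Holds (𝔸.tenseExtension e) v) ↔
      ∀ i ∈ T, i.Holds (𝔸.tenseExtension e) v) :
    SoundStep 𝔸 e ⟨S, main⟩ ⟨T, main⟩ :=
  ⟨hsyn, fun _ hX v hv hT => hX v hv ((h v).2 hT), fun hY v hv hS => hY v hv ((h v).1 hS)⟩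

theorem SplitStep.synClosed {S T : Finset (EIneq L)} (h : SplitStep S T) {main : EIneq L}
    (hS : System.SynClosed ⟨S, main⟩) : System.SynClosed ⟨T, main⟩ := by
  cases h with
  | mk i j k hi h =>
    have hjk : ∀ x, x = j ∨ x = k → x.lhs.SynClosed .pos ∧ x.rhs.SynClosed .neg := by
      have := hS i hi
      cases h with
      | meet α β γ =>
        rintro x (rfl | rfl)
        · exact ⟨this.1, this.2.1⟩
        · exact ⟨this.1, this.2.2⟩
      | join α β γ =>
        rintro x (rfl | rfl)
        · exact ⟨this.1.1, this.2⟩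
        · exact ⟨this.1.2, this.2⟩
    intro x hx
    simp only [Finset.mem_insert] at hx
    rcases hx with hx | hx | hx
    · exact hjk x (.inl hx)
    · exact hjk x (.inr hx)
    · exact hS x (Finset.mem_of_mem_erase hx)

/-- The order types of the residuals are chosen so that every side argument keeps its sign when the
inequality is rewritten. The new connective appears at the root with exactly the sign allowed for
it. -/
theorem Residuation.synClosed {i j : EIneq L} (h : Residuation i j)
    (hi : i.lhs.SynClosed .pos ∧ i.rhs.SynClosed .neg) :
    j.lhs.SynClosed .pos ∧ j.rhs.SynClosed .neg := by
  cases h with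
  | fPos f i h φ ψ =>
    obtain ⟨⟨-, hφ⟩, hψ⟩ := hi
    refine ⟨by have := hφ i; simp only [h] at this; exact this, .inl rfl, fun j => ?_⟩
    change (update φ i ψ j).SynClosed (Pol.neg.through (residualType (L.epsF f) i j))
    rcases eq_or_ne j i with hj | hj
    · simpa [hj, residualType, h, Pol.through] using hψ
    · have := hφ j
      simp only [residualType, h, hj, if_false, update_of_ne hj]
      cases hε : L.epsF f j <;> simp only [hε] at this <;> exact this
  | fNeg f i h φ ψ =>
    obtain ⟨⟨-, hφ⟩, hψ⟩ := hi
    refine ⟨⟨.inl rfl, fun j => ?_⟩, by have := hφ i; simp only [h] at this; exact this⟩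
    change (update φ i ψ j).SynClosed (Pol.pos.through (residualType (L.epsF f) i j))
    rcases eq_or_ne j i with hj | hj
    · simpa [hj, residualType, h, Pol.through, Pol.op] using hψ
    · have := hφ j
      simp only [residualType, h, update_of_ne hj]
      exact this
  | gPos g i h φ ψ =>
    obtain ⟨hψ, ⟨-, hφ⟩⟩ := hi
    refine ⟨⟨.inl rfl, fun j => ?_⟩, by have := hφ i; simp only [h] at this; exact this⟩
    change (update φ i ψ j).SynClosed (Pol.pos.through (residualType (L.epsG g) i j))
    rcases eq_or_ne j i with hj | hj
    · simpa [hj, residualType, h, Pol.through] using hψ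
    · have := hφ j
      simp only [residualType, h, hj, if_false, update_of_ne hj]
      cases hε : L.epsG g j <;> simp only [hε] at this <;> exact this
  | gNeg g i h φ ψ =>
    obtain ⟨hψ, ⟨-, hφ⟩⟩ := hi
    refine ⟨by have := hφ i; simp only [h] at this; exact this, .inl rfl, fun j => ?_⟩
    change (update φ i ψ j).SynClosed (Pol.neg.through (residualType (L.epsG g) i j))
    rcases eq_or_ne j i with hj | hj
    · simpa [hj, residualType, h, Pol.through, Pol.op] using hψ
    · have := hφ j
      simp only [residualType, h, update_of_ne hj]
      exact this

variable {𝔸 : LatticeExpansion L A} (he : IsCanonicalExtension e)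
include he

theorem Residuation.holds_iff {i j : EIneq L} (h : Residuation i j) (v : Atom → C) :
    i.Holds (𝔸.tenseExtension e) v ↔ j.Holds (𝔸.tenseExtension e) v := by
  cases h with
  | fPos f i h φ ψ =>
    have := (canonicalExtension_opF_complete (𝔸 := 𝔸) he f).le_iff_le_residual (i := i)
      (u := fun j => (φ j).eval (𝔸.tenseExtension e) v) (y := ψ.eval (𝔸.tenseExtension e) v)
    simp only [h] at this
    simp only [Ineq.Holds, Term.eval, Term.eval_update_args]
    exact this
  | fNeg f i h φ ψ =>
    have := (canonicalExtension_opF_complete (𝔸 := 𝔸) he f).le_iff_le_residual (i := i)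
      (u := fun j => (φ j).eval (𝔸.tenseExtension e) v) (y := ψ.eval (𝔸.tenseExtension e) v)
    simp only [h] at this
    simp only [Ineq.Holds, Term.eval, Term.eval_update_args]
    exact this
  | gPos g i h φ ψ =>
    have := (canonicalExtension_opG_complete (𝔸 := 𝔸) he g).le_iff_le_residual (i := i)
      (u := fun j => (φ j).eval (𝔸.tenseExtension e) v) (y := ψ.eval (𝔸.tenseExtension e) v)
    simp only [h] at this
    simp only [Ineq.Holds, Term.eval, Term.eval_update_args]
    exact this
  | gNeg g i h φ ψ =>
    have := (canonicalExtension_opG_complete (𝔸 := 𝔸) he g).le_iff_le_residual (i := i)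
      (u := fun j => (φ j).eval (𝔸.tenseExtension e) v) (y := ψ.eval (𝔸.tenseExtension e) v)
    simp only [h] at this
    simp only [Ineq.Holds, Term.eval, Term.eval_update_args]
    exact this

/-! #### Approximation -/

/-- SLR contexts preserve all joins, up to signs. -/
theorem Ctx.SLR.sSup_le (v : Atom → C) {X : Set C} : ∀ {D : Ctx L.tense Atom} {s : Pol} {y : C},
    D.SLR s → (∀ x ∈ X, s.le (D.eval (𝔸.tenseExtension e) v x) y) →
      s.le (D.eval (𝔸.tenseExtension e) v ((D.sign s).sSup X)) y
  | .hole, _, _, _, h => Pol.sSup_le h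
  | .opF c i a D, _, _, ⟨rfl, hD⟩, h => by
    have hc := tenseExtension_opF_complete (𝔸 := 𝔸) he c
    -- The bound for the inner context is the join of its values over `X`; the outer operator then
    -- distributes over that join.
    have ih := Ctx.SLR.sSup_le v (X := X) hD fun x hx =>
      Pol.le_sSup (Set.mem_image_of_mem (D.eval (𝔸.tenseExtension e) v) hx)
    refine Pol.le_trans (hc.mono.update ih) (hc.sSup_le _ _ _ _ ?_)
    rintro _ ⟨x, hx, rfl⟩
    exact h x hx
  | .opG c i a D, _, _, ⟨rfl, hD⟩, h => by
    have hc := tenseExtension_opG_complete (𝔸 := 𝔸) he c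
    have ih := Ctx.SLR.sSup_le v (X := X) hD fun x hx =>
      Pol.le_sSup (Set.mem_image_of_mem (D.eval (𝔸.tenseExtension e) v) hx)
    refine Pol.le_trans (hc.mono.update ih) (hc.sSup_le _ _ _ _ ?_)
    rintro _ ⟨x, hx, rfl⟩
    exact h x hx

/-- The common form of the approximation rules; `x` is the new nominal or co-nominal. -/
theorem soundStep_approx {s t : Pol} {x : Atom} {D : Ctx L.tense Atom} {γ : BTerm L}
    {δ : ETerm L} {S : Finset (EIneq L)} {main main' i₀ : EIneq L} (hD : D.SLR s)
    (hsign : D.sign s = t)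
    (hx : ∀ v, Admissible e Set.univ v → ∀ c ∈ signedClosed e t,
      Admissible e Set.univ (update v x c))
    (hfresh : ∀ i ∈ S, ¬ i.Occurs x) (hplug : ¬ (D.plug γ.embed).Occurs x) (hδ : ¬ δ.Occurs x)
    (hi₀ : ∀ v, i₀.Holds (𝔸.tenseExtension e) v ↔
      t.le (v x) (γ.embed.eval (𝔸.tenseExtension e) v))
    (hi₀' : i₀.lhs.SynClosed .pos ∧ i₀.rhs.SynClosed .neg)
    (hmain : ∀ v, main.Holds (𝔸.tenseExtension e) v ↔
      s.le ((D.plug γ.embed).eval (𝔸.tenseExtension e) v) (δ.eval (𝔸.tenseExtension e) v))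
    (hmain' : ∀ v, main'.Holds (𝔸.tenseExtension e) v ↔
      s.le ((D.plug (.atom x)).eval (𝔸.tenseExtension e) v) (δ.eval (𝔸.tenseExtension e) v)) :
    SoundStep 𝔸 e ⟨S, main⟩ ⟨insert i₀ S, main'⟩ := by
  subst hsign
  refine ⟨fun hS i hi => ?_, fun _ hX v hv hY => ?_, fun hY v hv hS => ?_⟩
  · rcases Finset.mem_insert.1 hi with rfl | hi
    · exact hi₀'
    · exact hS i hi
  · have h := (hmain v).1 (hX v hv fun i hi => hY i (Finset.mem_insert_of_mem hi))
    have h₀ := (hi₀ v).1 (hY i₀ (Finset.mem_insert_self _ _))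
    refine (hmain' v).2 (Pol.le_trans ?_ h)
    rw [Ctx.eval_plug, Ctx.eval_plug]
    exact hD.eval_mono (tenseExtension_isNormal he) v h₀
  · have key : ∀ c ∈ signedClosed e (D.sign s),
        (D.sign s).le c (γ.embed.eval (𝔸.tenseExtension e) v) →
        s.le (D.eval (𝔸.tenseExtension e) v c) (δ.eval (𝔸.tenseExtension e) v) := by
      intro c hc hcγ
      have h := (hmain' _).1 (hY (update v x c) (hx v hv c hc) fun i hi => ?_)
      · rw [Ctx.eval_plug, D.eval_update_of_not_occurs v c _ hplug,
          Term.eval_update_of_not_occurs hδ] at h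
        simpa [Term.eval] using h
      · rcases Finset.mem_insert.1 hi with rfl | hi
        · rw [hi₀, Term.eval_update_of_not_occurs fun h => hplug (D.occurs_plug h)]
          simpa using hcγ
        · exact (Ineq.holds_update (hfresh i hi) v c).2 (hS i hi)
    rw [hmain, Ctx.eval_plug]
    -- The value of `γ` is the join of these `c` by denseness, and the SLR context preserves the
    -- join.
    refine Pol.le_trans (hD.eval_mono (tenseExtension_isNormal he) v
      (he.le_of_closed fun c hc hcγ => ?_)) (hD.sSup_le he v (X := {c | c ∈ signedClosed e
        (D.sign s) ∧ (D.sign s).le c (γ.embed.eval (𝔸.tenseExtension e) v)})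
        fun c hc => key c hc.1 hc.2)
    exact Pol.le_sSup ⟨hc, hcγ⟩

theorem PivotalApprox.soundStep {X Y : System L} (h : PivotalApprox X Y) : SoundStep 𝔸 e X Y := by
  cases h with
  | leftPos S D γ ψ j hpiv hsign hj =>
    have hj := hj.1
    simp only [System.Occurs, Ineq.Occurs, Set.mem_ofPred_eq, not_or, not_exists, not_and] at hj
    exact soundStep_approx he hpiv.1 hsign (fun v hv c hc => hv.update_nom j hc)
      (fun i hi h => h.elim (hj.1 i hi).1 (hj.1 i hi).2) hj.2.1 hj.2.2
      (fun v => Iff.rfl) ⟨rfl, γ.synClosed_embed _⟩ (fun v => Iff.rfl) fun v => Iff.rfl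
  | leftNeg S D γ ψ m hpiv hsign hm =>
    have hj := hm.1
    simp only [System.Occurs, Ineq.Occurs, Set.mem_ofPred_eq, not_or, not_exists, not_and] at hj
    exact soundStep_approx he hpiv.1 hsign (fun v hv c hc => hv.update_conom m hc)
      (fun i hi h => h.elim (hj.1 i hi).1 (hj.1 i hi).2) hj.2.1 hj.2.2
      (fun v => Iff.rfl) ⟨γ.synClosed_embed _, rfl⟩ (fun v => Iff.rfl) fun v => Iff.rfl
  | rightPos S D γ φ j hpiv hsign hj =>
    have hj := hj.1
    simp only [System.Occurs, Ineq.Occurs, Set.mem_ofPred_eq, not_or, not_exists, not_and] at hj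
    exact soundStep_approx he hpiv.1 hsign (fun v hv c hc => hv.update_nom j hc)
      (fun i hi h => h.elim (hj.1 i hi).1 (hj.1 i hi).2) hj.2.2 hj.2.1
      (fun v => Iff.rfl) ⟨rfl, γ.synClosed_embed _⟩ (fun v => Iff.rfl) fun v => Iff.rfl
  | rightNeg S D γ φ m hpiv hsign hm =>
    have hj := hm.1
    simp only [System.Occurs, Ineq.Occurs, Set.mem_ofPred_eq, not_or, not_exists, not_and] at hj
    exact soundStep_approx he hpiv.1 hsign (fun v hv c hc => hv.update_conom m hc)
      (fun i hi h => h.elim (hj.1 i hi).1 (hj.1 i hi).2) hj.2.2 hj.2.1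
      (fun v => Iff.rfl) ⟨γ.synClosed_embed _, rfl⟩ (fun v => Iff.rfl) fun v => Iff.rfl

/-! #### Ackermann's rules -/

/-- The common form of the Ackermann rules; `big` is the join or meet of the terms `αs`, and `T`
consists of the inequalities between these terms and `p`. -/
theorem soundStep_ackermann {σ : Pol} {p : ℕ} {αs : List (ETerm L)} {big : ETerm L}
    {T R : Finset (EIneq L)} {main : EIneq L}
    (hbig : ∀ v y, σ.le (big.eval (𝔸.tenseExtension e) v) y ↔
      ∀ α ∈ αs, σ.le (α.eval (𝔸.tenseExtension e) v) y)
    (hbig' : ¬ big.Occurs (.prop p)) (hα : ∀ α ∈ αs, ¬ α.Occurs (.prop p))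
    (hsyn : System.SynClosed ⟨T ∪ R, main⟩ → big.SynClosed σ)
    (hT : ∀ v, (∀ i ∈ T, i.Holds (𝔸.tenseExtension e) v) ↔
      ∀ α ∈ αs, σ.le (α.eval (𝔸.tenseExtension e) v) (v (.prop p)))
    (hmain : ¬ main.Occurs (.prop p))
    (hl : ∀ i ∈ R, ¬ i.lhs.OccursWith (.prop p) σ.op .pos)
    (hr : ∀ i ∈ R, ¬ i.rhs.OccursWith (.prop p) σ .pos) :
    SoundStep 𝔸 e ⟨T ∪ R, main⟩ ⟨R.image fun i => i.subst (.prop p) big, main⟩ := by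
  have hr' : ∀ i ∈ R, ¬ i.rhs.OccursWith (.prop p) σ.op .neg :=
    fun i hi h => hr i hi (i.rhs.occursWith_of_op σ .pos h)
  refine ⟨fun hX i hi => ?_, fun hsynX hX v hv hY => ?_, fun hY v hv hX => ?_⟩
  · obtain ⟨i, hiR, rfl⟩ := Finset.mem_image.1 hi
    obtain ⟨h₁, h₂⟩ := hX i (Finset.mem_union_right _ hiR)
    exact ⟨(hsyn hX).subst _ _ h₁ (hl i hiR), (hsyn hX).subst _ _ h₂ (hr' i hiR)⟩
  · set c : C := big.eval (𝔸.tenseExtension e) v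
    have hrange : ∀ {x : C} (s : Pol), x ∈ Set.range e → x ∈ signedClosed e s := by
      rintro _ s ⟨a, rfl⟩; exact map_mem_signedClosed e s a
    -- Since `p` does not occur in `big`, its polarity condition is vacuous, and the approximation
    -- lemma is used only for the closedness of the value.
    have hc : c ∈ signedClosed e σ :=
      ((hsyn hsynX).approximates he (σ := σ) (p := p) (fun q _ => hv.prop q)
        (hrange _ (hv.prop p)) hv.nom hv.conom _ _ fun h => hbig' h.occurs).1
    have hu := fun (t : ETerm L) (s : Pol) => Term.SynClosed.approximates (𝔸 := 𝔸) he (σ := σ)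
      (p := p) (v := update v (.prop p) c)
      (fun q hq => by simpa [update_of_ne, hq] using hv.prop q) (by simpa using hc)
      (fun k => by simpa using hv.nom k) (fun k => by simpa using hv.conom k) t s
    simp only [update_self, update_idem] at hu
    have hR : ∀ i ∈ R, ∀ᶠ a in approxFilter e σ c,
        i.Holds (𝔸.tenseExtension e) (update v (.prop p) (e a)) := by
      intro i hi
      obtain ⟨h₁, h₂⟩ := hsynX i (Finset.mem_union_right _ hi)
      obtain ⟨hk, hka⟩ := hu _ _ h₁ (hl i hi)
      obtain ⟨ho, hoa⟩ := hu _ _ h₂ (hr' i hi)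
      have hle : i.Holds (𝔸.tenseExtension e) (update v (.prop p) c) :=
        (i.holds_subst _ _ _).1 (hY _ (Finset.mem_image_of_mem _ hi))
      -- The separating `b` is fixed before `p` is approximated: both sides move towards it as the
      -- value of `p` moves away from `c`, but eventually neither crosses it.
      obtain ⟨b, hkb, hbo⟩ := he.exists_between hk ho hle
      obtain ⟨b₁, hb₁, hka⟩ := hka _ (map_mem_signedClosed e _ b) hkb
      obtain ⟨b₂, hb₂, hoa⟩ := hoa _ (map_mem_signedClosed e _ b) hbo
      filter_upwards [hka, hoa] with a h h'
      have h₃ := Pol.le_trans h hb₁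
      have h₄ := Pol.le_trans h' hb₂
      exact _root_.le_trans h₃ h₄
    -- Finiteness of `R` gives one value `a` in `A` that bounds the terms `αs` and satisfies all of
    -- `R` simultaneously.
    obtain ⟨a, hca, ha⟩ := ((eventually_approxFilter_le (e := e) c).and
      ((Filter.eventually_all_finset R).2 hR)).exists
    have := hX (update v (.prop p) (e a)) (hv.update_prop p ⟨a, rfl⟩) fun i hi => ?_
    · exact (Ineq.holds_update hmain v _).1 this
    · rcases Finset.mem_union.1 hi with hi | hi
      · refine (hT _).2 (fun α hα' => ?_) i hi
        rw [Term.eval_update_of_not_occurs (hα α hα'), update_self]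
        exact (hbig v _).1 hca α hα'
      · exact ha i hi
  -- For this direction the assignment stays the same: replacing `p` by `big` lowers the left-hand
  -- sides and raises the right-hand sides, because `big` is on the correct side of `p`.
  · refine hY v hv fun i hi => ?_
    obtain ⟨i, hiR, rfl⟩ := Finset.mem_image.1 hi
    rw [Ineq.holds_subst]
    have hle := (hbig v _).2 ((hT v).1 fun i hi => hX i (Finset.mem_union_left _ hi))
    have h₁ := i.lhs.eval_le_eval (tenseExtension_isNormal (𝔸 := 𝔸) he)
      (v := update v (.prop p) (big.eval (𝔸.tenseExtension e) v)) (v' := v)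
      (fun y hy => update_of_ne hy _ _) (by simpa using hle) _ (hl i hiR)
    have h₂ := i.rhs.eval_le_eval (tenseExtension_isNormal (𝔸 := 𝔸) he)
      (v := update v (.prop p) (big.eval (𝔸.tenseExtension e) v)) (v' := v)
      (fun y hy => update_of_ne hy _ _) (by simpa using hle) _ (hr' i hiR)
    exact _root_.le_trans h₁ (_root_.le_trans (hX i (Finset.mem_union_right _ hiR)) h₂)

theorem Ackermann.soundStep {X Y : System L} (h : Ackermann X Y) : SoundStep 𝔸 e X Y := by
  cases h with
  | right p αs R main hα hmain hβ hγ =>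
    refine soundStep_ackermann he (σ := .pos) (αs := αs) (fun v y => Term.eval_bigJoin_le)
      (fun h => ?_) hα (fun hX => Term.SynClosed.bigJoin fun α hα' => ?_) (fun v => ?_) hmain hβ hγ
    · obtain ⟨t, ht, h⟩ := Term.occurs_bigJoin h
      exact hα t ht h
    · exact (hX ⟨α, .atom (.prop p)⟩ (by simp [hα'])).1
    · simp only [List.mem_toFinset, List.forall_mem_map]
      exact Iff.rfl
  | left p αs R main hα hmain hβ hγ =>
    refine soundStep_ackermann he (σ := .neg) (αs := αs) (fun v y => Term.le_eval_bigMeet)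
      (fun h => ?_) hα (fun hX => Term.SynClosed.bigMeet fun α hα' => ?_) (fun v => ?_) hmain hβ hγ
    · obtain ⟨t, ht, h⟩ := Term.occurs_bigMeet h
      exact hα t ht h
    · exact (hX ⟨.atom (.prop p), α⟩ (by simp [hα'])).2
    · simp only [List.mem_toFinset, List.forall_mem_map]
      exact Iff.rfl

theorem PivotalStep.soundStep {X Y : System L} (h : PivotalStep X Y) : SoundStep 𝔸 e X Y := by
  cases h with
  | approx X Y h => exact h.soundStep he
  | residuation S main i j hi h =>
    refine .of_holds_iff (fun hS k hk => ?_) fun v => ?_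
    · rcases Finset.mem_insert.1 hk with rfl | hk
      · exact h.synClosed (hS i hi)
      · exact hS k (Finset.mem_of_mem_erase hk)
    · conv_lhs => rw [← Finset.insert_erase hi]
      simp only [Finset.forall_mem_insert, h.holds_iff he]
  | split S T main h => exact .of_holds_iff h.synClosed h.holds_iff
  | ackermann X Y h => exact h.soundStep he

/-! ### Canonicity -/

theorem SoundStep.of_reflTransGen {X Y : System L} (h : Relation.ReflTransGen PivotalStep X Y) :
    SoundStep 𝔸 e X Y := by
  induction h with
  | refl => exact ⟨id, fun _ => id, id⟩
  | tail _ h ih =>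
    have h' : SoundStep 𝔸 e _ _ := h.soundStep he
    exact ⟨fun hX => h'.synClosed (ih.synClosed hX),
      fun hX hv => h'.valid (ih.synClosed hX) (ih.valid hX hv),
      fun hv => ih.valid_of_valid (h'.valid_of_valid hv)⟩

omit he in
theorem System.Pure.valid_univ {Y : System L} (hY : Y.Pure) {O : Ops L.tense C}
    (h : Y.Valid O e (Set.range e)) : Y.Valid O e Set.univ := by
  intro v hv hS
  -- The value `e ⊥` is an arbitrary element of `A`: no proposition letter occurs, so resetting them
  -- all changes nothing in the system.
  set v' : Atom → C := fun x => match x with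
    | .prop _ => e ⊥
    | x => v x
  have hv' : Admissible e (Set.range e) v' := ⟨fun _ => ⟨⊥, rfl⟩, hv.nom, hv.conom⟩
  have hvv' : ∀ x, Y.Occurs x → v x = v' x := by
    rintro (p | _ | _) hx
    · exact absurd hx (hY p)
    · rfl
    · rfl
  exact (Ineq.holds_congr fun x hx => hvv' x (.inr hx)).2 (h v' hv' fun i hi =>
    (Ineq.holds_congr fun x hx => hvv' x (.inl ⟨i, hi, hx⟩)).1 (hS i hi))

/-- An inequality that is reduced to a pure system is canonical. -/
theorem canonical_of_reduces {k : BIneq L} {Y : System L}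
    (h : Relation.ReflTransGen PivotalStep ⟨∅, k.embed⟩ Y) (hY : Y.Pure)
    (hk : 𝔸.toOps.Valid k) : (𝔸.canonicalExtension e).Valid k := by
  have hstep : SoundStep 𝔸 e _ _ := SoundStep.of_reflTransGen he h
  have hvalid := hstep.valid_of_valid (hY.valid_univ (hstep.valid (by simp [System.SynClosed])
    fun v hv _ => ?_))
  · intro v
    -- Nominals and co-nominals do not occur in an embedded inequality; `e ⊥` serves for both
    -- because elements of `A` are closed and open.
    have := hvalid (fun x => match x with
      | .prop p => v p
      | .nom _ => e ⊥
      | .conom _ => e ⊥)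
      ⟨fun _ => trivial, fun _ => map_mem_signedClosed e _ _,
        fun _ => map_mem_signedClosed e _ _⟩ (by simp)
    simp only [Ineq.Holds, Ineq.embed, eval_embed] at this
    exact this
  -- With letters valued in `A`, the canonical extension computes the same values as `𝔸`.
  · choose a ha using hv.prop
    simp only [Ineq.Holds, Ineq.embed, eval_embed, ← ha, eval_canonicalExtension he]
    exact OrderHomClass.mono e (hk a)

end Steps

end LatExp

theorem mainTheorem2 (L : LatExp.Signature.{u}) (φ ψ : LatExp.BTerm L)
    (hsucc : LatExp.ALBASucceedsPivotally ⟨φ, ψ⟩)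
    (A : Type v) [Lattice A] [BoundedOrder A] (𝔸 : LatExp.LatticeExpansion L A)
    (C : Type w) [CompleteLattice C] (e : BoundedLatticeHom A C)
    (he : LatExp.IsCanonicalExtension e)
    (hvalid : 𝔸.toOps.Valid ⟨φ, ψ⟩) :
    (𝔸.canonicalExtension e).Valid ⟨φ, ψ⟩ := by
  obtain ⟨I, hI, hred⟩ := hsucc
  rw [hI.valid_iff (LatExp.canonicalExtension_isNormal he)]
  intro k hk
  obtain ⟨Y, hY, hpure⟩ := hred k hk
  exact LatExp.canonical_of_reduces he hY hpure ((hI.valid_iff 𝔸.isNormal).1 hvalid k hk)
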